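/- Let $E = \mathbb{R} \times \{-1,+1\}$ and let $C_0(E)$ be the Banach space of real continuous functions on $E$ vanishing at infinity. Let $a > 0$ and let $\lambda : E \to [0,\infty)$ be continuous. Suppose there are constants $y_0 \ge 0$ and $\lambda_{\min} > 0$ such that $\lambda(y,j) \ge \lambda_{\min}$ whenever $jy \ge y_0$. Let $L$ be the operator on $C_0(E)$ \[ L\varphi(y,j) = a j\, \partial_y \varphi(y,j) + \lambda(y,j)\,(\varphi(y,-j) - \varphi(y,j)), \] with domain $D(L)$ the set of $\varphi \in C_0(E)$ such that $\varphi(\cdot,\pm 1) \in C^1(\mathbb{R})$ and $L\varphi \in C_0(E)$. Put $F(t;y,j) = \exp\bigl(-\int_0^t \lambda(y+ajs,j)\,ds\bigr)$ for $t \ge 0$. For $(y,j) \in E$, the zig-zag process started in $(y,j)$ is constructed as follows. Let $T_0 = 0$, $(Y(0),J(0)) = (y,j)$. For $i = 1,2,\dots$ let $Z_i$ be a strictly positive random variable with $\mathbb{P}_{y,j}(Z_i > t \mid Z_1,\dots,Z_{i-1}) = F(t; Y(T_{i-1}), J(T_{i-1}))$ for all $t \ge 0$, let $T_i = T_{i-1}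 + Z_i$, and put $J(t) = J(T_{i-1})$ for $T_{i-1} \le t < T_i$, $J(T_i) = -J(T_{i-1})$, and $Y(t) = Y(T_{i-1}) + a J(T_{i-1})(t - T_{i-1})$ for $T_{i-1} \le t \le T_i$. (On the event $\lim_k T_k < \infty$ put, as a mere convention, $(Y(t),J(t)) = (y+ajt,j)$ for $t \ge \lim_k T_k$.) Let $\mathcal{F}_t = \sigma((Y(s),J(s)) : s \le t)$. Then such random variables $Z_i$ exist for every $(y,j) \in E$, and: 1. (Non-explosion) $T_k \to \infty$ as $k \to \infty$, $\mathbb{P}_{y,j}$-almost surely, for every $(y,j) \in E$. 2. (Strong Markov property) There is a semigroup $(P(t))_{t\ge 0}$ of Markov kernels on $E$, with $P(0)$ the identity, such that $P(t)((y,j),\cdot)$ is the law of $(Y(t),J(t))$ under $\mathbb{P}_{y,j}$, and for every $(y,j) \in E$, every $(\mathcal{F}_t)$-stopping time $\tau$ with values in $[0,\infty]$, every $t \ge 0$ and every bounded Borel function $f : E \to \mathbb{R}$, $\mathbb{P}_{y,j}$-almost surely \[ \mathbb{E}_{y,j}\bigl[f(Y(\tau+t),J(\tau+t))\,\mathbf{1}_{\{\tau<\infty\}}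 \mid \mathcal{F}_\tau\bigr] = \mathbf{1}_{\{\tau<\infty\}}\,(P(t)f)(Y(\tau),J(\tau)). \] 3. (Generator) $L$ is closable, and its closure is the infinitesimal generator of $(P(t))$ on $C_0(E)$, that is, the operator whose graph is the set of all $(\varphi,g) \in C_0(E) \times C_0(E)$ with $\lim_{t \downarrow 0} \sup_{x \in E} \bigl| t^{-1}(P(t)\varphi(x) - \varphi(x)) - g(x) \bigr| = 0$. -/

import Mathlib

open MeasureTheory ProbabilityTheory Filter Topology Set
open scoped NNReal ZeroAtInfty

namespace ZigZag

/-- The state space `E = ℝ × {-1, +1}`; `ℤˣ = {1, -1}` carries the discrete topology. -/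
abbrev E : Type := ℝ × ℤˣ

/-- The direction `j ∈ {-1, +1}` as a real number. -/
abbrev sgn (j : ℤˣ) : ℝ := ((j : ℤ) : ℝ)

instance : DiscreteMeasurableSpace ℤˣ where
  forall_measurableSet s := ⟨Units.val '' s, MeasurableSet.of_discrete, by
    ext j; simp [Units.val_inj]⟩

instance : BorelSpace ℤˣ where
  measurable_eq := by
    rw [borel_eq_top_of_discrete]
    exact top_unique fun s _ => MeasurableSet.of_discrete

noncomputable section

/-! ### The operator on `C₀(E)` -/

/-- The expression `a j ∂φ/∂y (y, j) + lam (y, j) (φ (y, -j) - φ (y, j))`. -/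
def genExpr (a : ℝ) (lam : E → ℝ) (φ : E → ℝ) (x : E) : ℝ :=
  a * sgn x.2 * deriv (fun y : ℝ => φ (y, x.2)) x.1 + lam x * (φ (x.1, -x.2) - φ x)

/-- `φ ∈ D(L)`: both `φ(·, ±1)` are continuously differentiable and `L φ` is continuous and
vanishes at infinity. -/
def InDomain (a : ℝ) (lam : E → ℝ) (φ : E → ℝ) : Prop :=
  (∀ j : ℤˣ, ContDiff ℝ 1 (fun y : ℝ => φ (y, j))) ∧
    Continuous (genExpr a lam φ) ∧ Tendsto (genExpr a lam φ) (cocompact E) (𝓝 0)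

lemma genExpr_add {a : ℝ} {lam φ ψ : E → ℝ}
    (hφ : ∀ j : ℤˣ, ContDiff ℝ 1 (fun y : ℝ => φ (y, j)))
    (hψ : ∀ j : ℤˣ, ContDiff ℝ 1 (fun y : ℝ => ψ (y, j))) :
    genExpr a lam (φ + ψ) = genExpr a lam φ + genExpr a lam ψ := by
  funext x
  have h1 : deriv (fun y : ℝ => (φ + ψ) (y, x.2)) x.1
      = deriv (fun y : ℝ => φ (y, x.2)) x.1 + deriv (fun y : ℝ => ψ (y, x.2)) x.1 :=
    deriv_fun_add ((hφ x.2).differentiable (by simp) x.1) ((hψ x.2).differentiable (by simp) x.1)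
  simp only [genExpr, Pi.add_apply] at h1 ⊢
  rw [h1]
  ring

lemma genExpr_smul {a : ℝ} {lam φ : E → ℝ} (c : ℝ) :
    genExpr a lam (c • φ) = c • genExpr a lam φ := by
  funext x
  have h1 : deriv (fun y : ℝ => (c • φ) (y, x.2)) x.1
      = c * deriv (fun y : ℝ => φ (y, x.2)) x.1 := by
    simp only [Pi.smul_apply, smul_eq_mul]
    exact deriv_const_mul_field c
  simp only [genExpr, Pi.smul_apply, smul_eq_mul] at h1 ⊢
  rw [h1]
  ring

/-- The domain of `L` as a linear subspace of `C₀(E)`. -/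
def genDomain (a : ℝ) (lam : E → ℝ) : Submodule ℝ C₀(E, ℝ) where
  carrier := {φ | InDomain a lam φ}
  zero_mem' := by
    have h : genExpr a lam (⇑(0 : C₀(E, ℝ))) = fun _ => 0 := by
      funext x; simp [genExpr]
    refine ⟨fun j => ?_, ?_, ?_⟩
    · simpa using (contDiff_const : ContDiff ℝ 1 fun _ : ℝ => (0 : ℝ))
    · rw [h]; exact continuous_const
    · rw [h]; exact tendsto_const_nhds
  add_mem' := by
    rintro φ ψ ⟨h1, h2, h3⟩ ⟨k1, k2, k3⟩
    have h := genExpr_add (a := a) (lam := lam) h1 k1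
    refine ⟨fun j => by simpa using (h1 j).add (k1 j), ?_, ?_⟩
    · rw [ZeroAtInftyContinuousMap.coe_add, h]; exact h2.add k2
    · have h4 := h3.add k3
      rw [add_zero] at h4
      rw [ZeroAtInftyContinuousMap.coe_add, h]; exact h4
  smul_mem' := by
    rintro c φ ⟨h1, h2, h3⟩
    have h := genExpr_smul (a := a) (lam := lam) (φ := φ) c
    refine ⟨fun j => by simpa using contDiff_const.mul (h1 j), ?_, ?_⟩
    · rw [ZeroAtInftyContinuousMap.coe_smul, h]; exact h2.const_smul c
    · have h4 := h3.const_smul c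
      rw [smul_zero] at h4
      rw [ZeroAtInftyContinuousMap.coe_smul, h]; exact h4

/-- The unbounded operator `L` on `C₀(E)`,
`L φ (y, j) = a j ∂φ/∂y (y, j) + lam (y, j) (φ (y, -j) - φ (y, j))`. -/
def L (a : ℝ) (lam : E → ℝ) : C₀(E, ℝ) →ₗ.[ℝ] C₀(E, ℝ) where
  domain := genDomain a lam
  toFun :=
    { toFun := fun φ => ⟨⟨genExpr a lam φ.1, φ.2.2.1⟩, φ.2.2.2⟩
      map_add' := fun φ ψ => by
        ext x
        exact congrFun (genExpr_add φ.2.1 ψ.2.1) x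
      map_smul' := fun c φ => by
        ext x
        exact congrFun (genExpr_smul c) x }

/-! ### The process -/

/-- The survival function `F(t; y, j) = exp (-∫₀ᵗ lam (y + a j s, j) ds)`. -/
def survival (a : ℝ) (lam : E → ℝ) (t : ℝ) (x : E) : ℝ :=
  Real.exp (-∫ s in (0 : ℝ)..t, lam (x.1 + a * sgn x.2 * s, x.2))

/-- The state `(Y(T_n), J(T_n))` at the `n`-th switch, for the initial state `e` and the waiting
times `z 0, z 1, …` (`z n` is the time between the `n`-th and the `(n+1)`-st switch). -/
def skeleton (a : ℝ) (e : E) (z : ℕ → Ioi (0 : ℝ)) : ℕ → E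
  | 0 => e
  | n + 1 => ((skeleton a e z n).1 + a * sgn (skeleton a e z n).2 * (z n : ℝ),
      -(skeleton a e z n).2)

/-- The time `T_n` of the `n`-th switch. -/
def switchTime (z : ℕ → Ioi (0 : ℝ)) (n : ℕ) : ℝ := ∑ k ∈ Finset.range n, (z k : ℝ)

/-- The number `N(t)` of switches up to time `t` (it has the default value `0` if there are
infinitely many of them). -/
def switchCount (z : ℕ → Ioi (0 : ℝ)) (t : ℝ≥0) : ℕ := sSup {k : ℕ | switchTime z k ≤ t}

/-- The zig-zag path `(Y(t), J(t))` with initial state `e` and waiting times `z`: for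
`T_n ≤ t < T_{n+1}` it is `(Y(T_n) + a J(T_n) (t - T_n), J(T_n))`. -/
def path (a : ℝ) (e : E) (z : ℕ → Ioi (0 : ℝ)) (t : ℝ≥0) : E :=
  ((skeleton a e z (switchCount z t)).1
      + a * sgn (skeleton a e z (switchCount z t)).2 * ((t : ℝ) - switchTime z (switchCount z t)),
    (skeleton a e z (switchCount z t)).2)

lemma measurable_skeleton (a : ℝ) (e : E) (n : ℕ) :
    Measurable (fun z : ℕ → Ioi (0 : ℝ) => skeleton a e z n) := by
  have hs : Measurable sgn := measurable_of_countable _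
  have hn : Measurable (fun j : ℤˣ => -j) := measurable_of_countable _
  induction n with
  | zero => exact measurable_const
  | succ n ih =>
    have hz : Measurable (fun z : ℕ → Ioi (0 : ℝ) => ((z n : Ioi (0 : ℝ)) : ℝ)) :=
      measurable_subtype_coe.comp (measurable_pi_apply n)
    exact (ih.fst.add (((hs.comp ih.snd).const_mul a).mul hz)).prodMk (hn.comp ih.snd)

lemma measurable_switchTime (n : ℕ) : Measurable (fun z => switchTime z n) :=
  Finset.measurable_sum _ fun k _ => measurable_subtype_coe.comp (measurable_pi_apply k)

lemma measurable_switchCount (t : ℝ≥0) : Measurable (fun z => switchCount z t) := by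
  have h : ∀ k, MeasurableSet {z : ℕ → Ioi (0 : ℝ) | switchTime z k ≤ t} := fun k =>
    measurableSet_le (measurable_switchTime k) measurable_const
  refine measurable_of_Iic fun n => ?_
  have h1 : (fun z => switchCount z t) ⁻¹' Iic n
      = (⋂ k : ℕ, ⋃ m ≥ k, {z : ℕ → Ioi (0 : ℝ) | switchTime z m ≤ t})
        ∪ ⋂ k ∈ {k : ℕ | n < k}, {z : ℕ → Ioi (0 : ℝ) | switchTime z k ≤ t}ᶜ := by
    ext z
    simp only [switchCount, mem_preimage, mem_Iic, mem_union, mem_iInter, mem_iUnion, mem_ofPred_eq,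
      mem_compl_iff, exists_prop]
    constructor
    · intro hz
      by_cases hb : BddAbove {k : ℕ | switchTime z k ≤ t}
      · exact Or.inr fun k hk hk' => absurd ((le_csSup hb hk').trans hz) (not_le.mpr hk)
      · refine Or.inl fun k => ?_
        obtain ⟨m, hm, hkm⟩ := not_bddAbove_iff.mp hb k
        exact ⟨m, hkm.le, hm⟩
    · rintro (hz | hz)
      · have hb : ¬ BddAbove {k : ℕ | switchTime z k ≤ t} := by
          refine not_bddAbove_iff.mpr fun k => ?_
          obtain ⟨m, hkm, hm⟩ := hz (k + 1)
          exact ⟨m, hm, hkm⟩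
        rw [Nat.sSup_of_not_bddAbove hb]
        exact Nat.zero_le n
      · exact csSup_le' fun k hk => not_lt.mp fun hnk => hz k hnk hk
  rw [h1]
  refine MeasurableSet.union ?_ ?_
  · exact MeasurableSet.iInter fun k => MeasurableSet.iUnion fun m => MeasurableSet.iUnion fun _ =>
      h m
  · exact MeasurableSet.iInter fun k => MeasurableSet.iInter fun _ => (h k).compl

lemma measurable_path (a : ℝ) (e : E) (t : ℝ≥0) : Measurable (fun z => path a e z t) := by
  have hs : Measurable sgn := measurable_of_countable _
  have key : ∀ n, Measurable (fun z : ℕ → Ioi (0 : ℝ) =>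
      (((skeleton a e z n).1 + a * sgn (skeleton a e z n).2 * ((t : ℝ) - switchTime z n),
        (skeleton a e z n).2) : E)) := fun n =>
    ((measurable_skeleton a e n).fst.add (((hs.comp (measurable_skeleton a e n).snd).const_mul a).mul
      ((measurable_switchTime n).const_sub _))).prodMk (measurable_skeleton a e n).snd
  have h2 : Measurable (fun p : (ℕ → Ioi (0 : ℝ)) × ℕ =>
      (((skeleton a e p.1 p.2).1 + a * sgn (skeleton a e p.1 p.2).2 * ((t : ℝ) - switchTime p.1 p.2),
        (skeleton a e p.1 p.2).2) : E)) := measurable_from_prod_countable_left key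
  exact h2.comp (measurable_id.prodMk (measurable_switchCount t))

/-- `Z 0, Z 1, …` are, under `μ`, waiting times between the switches of a zig-zag process started
in `e`: given `Z 0, …, Z (n-1)`, the probability that `Z n > t` is `F(t; Y(T_n), J(T_n))`. -/
structure IsWaitingTimes {Ω : Type*} [MeasurableSpace Ω] (a : ℝ) (lam : E → ℝ) (e : E)
    (μ : Measure Ω) (Z : ℕ → Ω → Ioi (0 : ℝ)) : Prop where
  isProbabilityMeasure : IsProbabilityMeasure μ
  measurable : ∀ n, Measurable (Z n)
  condProb : ∀ (n : ℕ) (t : ℝ), 0 ≤ t →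
    μ⟦{ω | t < (Z n ω : ℝ)} | ⨆ k : Fin n, MeasurableSpace.comap (Z k) inferInstance⟧
      =ᵐ[μ] fun ω => survival a lam t (skeleton a e (fun k => Z k ω) n)

/-- The zig-zag process `(Y(t), J(t))` started in `e` with waiting times `Z`. -/
def process {Ω : Type*} (a : ℝ) (e : E) (Z : ℕ → Ω → Ioi (0 : ℝ)) (t : ℝ≥0) (ω : Ω) : E :=
  path a e (fun k => Z k ω) t

lemma measurable_process {Ω : Type*} [MeasurableSpace Ω] (a : ℝ) (e : E)
    {Z : ℕ → Ω → Ioi (0 : ℝ)} (hZ : ∀ n, Measurable (Z n)) (t : ℝ≥0) :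
    Measurable (process a e Z t) :=
  (measurable_path a e t).comp (measurable_pi_lambda _ hZ)

/-- The filtration `ℱ_t = σ((Y(s), J(s)) : s ≤ t)`. -/
def filtration {Ω : Type*} [m : MeasurableSpace Ω] (a : ℝ) (e : E)
    {Z : ℕ → Ω → Ioi (0 : ℝ)} (hZ : ∀ n, Measurable (Z n)) : Filtration ℝ≥0 m :=
  Filtration.natural (process a e Z) fun t => (measurable_process a e hZ t).stronglyMeasurable

/-! ### Markov processes and generators -/

/-- `P` is a (conservative, measurable) Markov transition semigroup on `S`. -/
structure IsMarkovSemigroup {S : Type*} [MeasurableSpace S] (P : ℝ≥0 → Kernel S S) : Prop where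
  isMarkovKernel : ∀ t, IsMarkovKernel (P t)
  zero : P 0 = Kernel.id
  add : ∀ s t, P (s + t) = P t ∘ₖ P s

/-- `X` is, under `μ`, a strong Markov process with respect to `ℱ` with transition semigroup `P`:
it is adapted, and for all stopping times `τ`, all `t ≥ 0` and all bounded measurable `f`,
`E[f(X_{τ+t}) 1_{τ<∞} | ℱ_τ] = 1_{τ<∞} (P_t f)(X_τ)` almost surely. -/
structure IsStrongMarkov {Ω S : Type*} [m : MeasurableSpace Ω] [MeasurableSpace S]
    (μ : Measure Ω) (ℱ : Filtration ℝ≥0 m) (X : ℝ≥0 → Ω → S) (P : ℝ≥0 → Kernel S S) : Prop where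
  adapted : ∀ t, Measurable[ℱ t] (X t)
  strong_markov : ∀ (τ : Ω → WithTop ℝ≥0) (hτ : IsStoppingTime ℱ τ) (t : ℝ≥0) (f : S → ℝ),
    Measurable f → (∃ C, ∀ x, |f x| ≤ C) →
    μ[{ω | τ ω < ⊤}.indicator fun ω => f (X ((τ ω).untopD 0 + t) ω) | hτ.measurableSpace]
      =ᵐ[μ] {ω | τ ω < ⊤}.indicator fun ω => ∫ x, f x ∂(P t (X ((τ ω).untopD 0) ω))

/-- The graph of the infinitesimal generator on `C₀(S)` of a transition semigroup `P`: all pairs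
`(φ, g)` in `C₀(S) × C₀(S)` such that `(P_t φ - φ) / t → g` uniformly on `S` as `t ↓ 0`. -/
def generatorGraph {S : Type*} [TopologicalSpace S] [MeasurableSpace S] (P : ℝ≥0 → Kernel S S) :
    Set (C₀(S, ℝ) × C₀(S, ℝ)) :=
  {p | TendstoUniformly (fun (t : ℝ≥0) (x : S) => (∫ z, p.1 z ∂(P t x) - p.1 x) / (t : ℝ))
    p.2 (𝓝[>] 0)}

end

end ZigZag

/-! Law of the waiting times. Every waiting time can be sampled from the current state and an
independent uniform variable, which realises the whole sequence as a Markov kernel `seqKernel` in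
the initial state. Its first-step decomposition `lintegral_seqKernel` (draw the first waiting time,
jump, start afresh) drives every induction on the number of switches. The law is unique
(`eq_of_isWaitingLaw`), so whatever is proved for `seqKernel` holds for every version of the
process.

Non-explosion. The position moves with speed at most `a`, so up to a fixed time the process stays in
a compact set, on which the rate is at most some `M`. Hence `n` switches occur by time `t` with
probability at most `(M t)^n / n!` (`seqKernel_switchTime_le`). The lower bound on the rate plays
another role: it makes the survival function tend to zero, so that each waiting time is finite.

Strong Markov property. An event up to time `s` depends only on the number of switches before `s`
and on the waiting times between them. Induction on that number gives the Markov property; the base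
case is the multiplicativity of the survival function along the flow. The semigroup preserves
continuity: expectations over fewer than `n` switches are continuous by recursion, and they converge
locally uniformly by the factorial bound. For right-continuous paths, dyadic approximation of
stopping times from above then gives the strong Markov property (`isStrongMarkov_of_feller`).

Generator. Let `R f = ∫₀^∞ e⁻ᵗ P_t f dt` and let `A` be the generator. The Laplace transform of the
renewal equation shows that `R f` is differentiable along the flow, lies in `D(L)` and satisfies `L
R f = R f - f` (`genExpr_resolvent`). By the semigroup property, `A R f = R f - f` as well
(`resolvent_mem_generatorGraph`). The positive maximum principle makes both `1 - L` and `1 - A`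
injective. So either graph is the set of `(φ, g)` with `R (φ - g) = φ`; the two coincide, and they
are closed because `R` is continuous. Thus `L` is itself closed and equals the generator. -/

namespace ZigZag

/-! ### Strong Markov property of right-continuous Feller processes -/

section StrongMarkov

open scoped BoundedContinuousFunction

/-- The smallest multiple of `2⁻ⁿ` that is strictly larger than `t`. -/
noncomputable def dyadicAbove (n : ℕ) (t : ℝ≥0) : ℝ≥0 := (⌊2 ^ n * t⌋₊ + 1) / 2 ^ n

lemma lt_dyadicAbove (n : ℕ) (t : ℝ≥0) : t < dyadicAbove n t := by
  rw [dyadicAbove, lt_div_iff₀ (by positivity), mul_comm]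
  exact Nat.lt_floor_add_one _

lemma dyadicAbove_le (n : ℕ) (t : ℝ≥0) : dyadicAbove n t ≤ t + (1 / 2) ^ n := by
  have h : (⌊2 ^ n * t⌋₊ : ℝ≥0) ≤ 2 ^ n * t := Nat.floor_le (by positivity)
  rw [dyadicAbove, div_le_iff₀ (by positivity), add_mul, ← mul_pow, mul_comm t]
  gcongr
  norm_num

lemma tendsto_dyadicAbove (t : ℝ≥0) : Tendsto (fun n => dyadicAbove n t) atTop (𝓝[≥] t) := by
  refine tendsto_nhdsWithin_iff.mpr ⟨?_, .of_forall fun n => (lt_dyadicAbove n t).le⟩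
  refine tendsto_of_tendsto_of_tendsto_of_le_of_le tendsto_const_nhds ?_
    (fun n => (lt_dyadicAbove n t).le) (fun n => dyadicAbove_le n t)
  have h : Tendsto (fun n : ℕ => ((1 / 2 : ℝ≥0)) ^ n) atTop (𝓝 0) :=
    NNReal.tendsto_pow_atTop_nhds_zero_of_lt_one (by rw [div_lt_one] <;> norm_num)
  simpa using h.const_add t

lemma measurable_floor_two_pow_mul (n : ℕ) : Measurable fun t : ℝ≥0 => ⌊2 ^ n * t⌋₊ :=
  Nat.measurable_floor.comp (measurable_id.const_mul _)

lemma measurable_dyadicAbove (n : ℕ) : Measurable (dyadicAbove n) := by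
  have h : Measurable fun k : ℕ => ((k : ℝ≥0) + 1) / 2 ^ n := measurable_of_countable _
  exact h.comp (measurable_floor_two_pow_mul n)

lemma integral_measure_comp {α β : Type*} [MeasurableSpace α] [MeasurableSpace β] {ν : Measure α}
    [SFinite ν] {κ : Kernel α β} [IsSFiniteKernel κ] {f : β → ℝ} (hf : Integrable f (κ ∘ₘ ν)) :
    ∫ y, f y ∂(κ ∘ₘ ν) = ∫ x, ∫ y, f y ∂κ x ∂ν := by
  rw [Measure.comp_eq_comp_const_apply] at hf ⊢
  rw [Kernel.integral_comp hf, Kernel.const_apply]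

variable {Ω S : Type*} {m : MeasurableSpace Ω} [TopologicalSpace S]
  [TopologicalSpace.PseudoMetrizableSpace S] [MeasurableSpace S] [BorelSpace S]

/-- Sampling the path at the dyadic time above `t` leaves only countably many time points;
right-continuity recovers the path in the limit. -/
lemma measurable_uncurry_of_rightContinuous {X : ℝ≥0 → Ω → S} (hX : ∀ t, Measurable (X t))
    (hr : ∀ ω t, ContinuousWithinAt (fun s => X s ω) (Ici t) t) :
    Measurable (fun p : ℝ≥0 × Ω => X p.1 p.2) := by
  refine measurable_of_tendsto_metrizable (f := fun n (p : ℝ≥0 × Ω) => X (dyadicAbove n p.1) p.2)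
    (fun n => ?_) (tendsto_pi_nhds.mpr fun p => (hr p.2 p.1).tendsto.comp (tendsto_dyadicAbove p.1))
  have h1 : Measurable (fun q : ℕ × Ω => X ((q.1 + 1) / 2 ^ n) q.2) :=
    measurable_from_prod_countable_right fun k => hX ((k + 1) / 2 ^ n)
  have h2 := h1.comp (((measurable_floor_two_pow_mul n).comp measurable_fst).prodMk
    (measurable_snd (α := ℝ≥0) (β := Ω)))
  simpa only [Function.comp_def, dyadicAbove] using h2

/-- Cutting the dyadic times off at `i` keeps the approximants measurable with respect to `ℱ i`. The
cut-off times still lie to the right of `t ≤ i`, so right-continuity applies. -/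
lemma isStronglyProgressive_of_rightContinuous [SecondCountableTopology S]
    {ℱ : Filtration ℝ≥0 m} {X : ℝ≥0 → Ω → S}
    (hX : ∀ t, Measurable[ℱ t] (X t))
    (hr : ∀ ω t, ContinuousWithinAt (fun s => X s ω) (Ici t) t) :
    IsStronglyProgressive ℱ X := by
  intro i
  have hmeas : @Measurable _ _ (@Prod.instMeasurableSpace _ _ _ (ℱ i)) _
      (fun p : Iic i × Ω => X p.1 p.2) := by
    let _ := ℱ i
    refine measurable_of_tendsto_metrizable
      (f := fun n (p : Iic i × Ω) => X (min (dyadicAbove n p.1) i) p.2)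
      (fun n => ?_) (tendsto_pi_nhds.mpr fun p => ?_)
    · have h1 : Measurable (fun q : ℕ × Ω => X (min ((q.1 + 1) / 2 ^ n) i) q.2) :=
        measurable_from_prod_countable_right fun k => (hX (min ((k + 1) / 2 ^ n) i)).mono (ℱ.mono (min_le_right _ _)) le_rfl
      have h2 := h1.comp (((measurable_floor_two_pow_mul n).comp
        (measurable_subtype_coe.comp measurable_fst)).prodMk
          (measurable_snd (α := Iic i) (β := Ω)))
      simpa only [Function.comp_def, dyadicAbove] using h2
    · refine (hr p.2 p.1).tendsto.comp (tendsto_nhdsWithin_iff.mpr ⟨?_, .of_forall fun n => ?_⟩)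
      · have := ((tendsto_dyadicAbove (p.1 : ℝ≥0)).mono_right nhdsWithin_le_nhds).min
          (tendsto_const_nhds (x := i))
        rwa [min_eq_left p.1.2] at this
      · exact le_min (lt_dyadicAbove n _).le p.1.2
  exact hmeas.stronglyMeasurable

variable {μ : Measure Ω} [IsProbabilityMeasure μ] {ℱ : Filtration ℝ≥0 m} {X : ℝ≥0 → Ω → S}
  {P : ℝ≥0 → Kernel S S}

/-- The dyadic approximations of `τ` take countably many values, and on each of their level sets the
Markov property at a fixed time applies. The limit uses right-continuity of the paths on both sides,
and the continuity of `P t f` on the right-hand side. -/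
lemma setIntegral_stopped_eq_of_feller (hP : ∀ t, IsMarkovKernel (P t))
    (hF : ∀ t (f : S →ᵇ ℝ), Continuous fun x => ∫ z, f z ∂(P t x))
    (hX : ∀ t, Measurable[ℱ t] (X t))
    (hr : ∀ ω t, ContinuousWithinAt (fun s => X s ω) (Ici t) t)
    (hM : ∀ s t A, MeasurableSet[ℱ s] A → ∀ f : S →ᵇ ℝ,
      ∫ ω in A, f (X (s + t) ω) ∂μ = ∫ ω in A, ∫ z, f z ∂(P t (X s ω)) ∂μ)
    {τ : Ω → WithTop ℝ≥0} (hτ : IsStoppingTime ℱ τ) (t : ℝ≥0) {A : Set Ω}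
    (hA : MeasurableSet[hτ.measurableSpace] A) (f : S →ᵇ ℝ) :
    ∫ ω in A ∩ {ω | τ ω < ⊤}, f (X ((τ ω).untopD 0 + t) ω) ∂μ
      = ∫ ω in A ∩ {ω | τ ω < ⊤}, ∫ z, f z ∂(P t (X ((τ ω).untopD 0) ω)) ∂μ := by
  have hXm := measurable_uncurry_of_rightContinuous (fun t => (hX t).mono (ℱ.le t) le_rfl) hr
  have hσ : Measurable fun ω => (τ ω).untopD 0 := hτ.measurable'.untopD 0
  have hgb : ∀ x, ‖∫ z, f z ∂(P t x)‖ ≤ ‖f‖ := fun x => by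
    have := norm_integral_le_of_norm_le_const (μ := P t x) (.of_forall fun z => f.norm_coe_le_norm z)
    simpa using this
  have hd := measurable_dyadicAbove
  have h1m : ∀ n, Measurable fun ω => f (X (dyadicAbove n ((τ ω).untopD 0) + t) ω) := fun n =>
    f.continuous.measurable.comp (hXm.comp ((((hd n).comp hσ).add_const t).prodMk measurable_id))
  have h2m : ∀ n, Measurable fun ω => ∫ z, f z ∂(P t (X (dyadicAbove n ((τ ω).untopD 0)) ω)) :=
    fun n => (hF t f).measurable.comp (hXm.comp (((hd n).comp hσ).prodMk measurable_id))
  have key : ∀ n, ∫ ω in A ∩ {ω | τ ω < ⊤}, f (X (dyadicAbove n ((τ ω).untopD 0) + t) ω) ∂μ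
      = ∫ ω in A ∩ {ω | τ ω < ⊤}, ∫ z, f z ∂(P t (X (dyadicAbove n ((τ ω).untopD 0)) ω)) ∂μ := by
    intro n
    let q : ℕ → ℝ≥0 := fun k => k / 2 ^ n
    -- The redundant set `τ ≤ q (k + 1)` is there because membership of `A` in the stopped σ-algebra
    -- is a statement about `A ∩ {τ ≤ i}`.
    let B : ℕ → Set Ω := fun k => ((A ∩ {ω | τ ω ≤ q (k + 1)}) ∩ {ω | τ ω < q (k + 1)}) \ {ω | τ ω < q k}
    have hq : ∀ k, q k ≤ q (k + 1) := fun k => by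
      simp only [q]; gcongr; simp
    have hBm : ∀ k, MeasurableSet[ℱ (q (k + 1))] (B k) := fun k =>
      ((hA.2 _).inter (hτ.measurableSet_lt _)).diff (hτ.measurableSet_lt_le (hq k))
    have hBmem : ∀ k ω, ω ∈ B k ↔ ω ∈ A ∧ τ ω < ⊤ ∧ ⌊2 ^ n * (τ ω).untopD 0⌋₊ = k := by
      intro k ω
      simp only [B, Set.mem_sdiff, mem_inter_iff, mem_ofPred_eq, not_lt]
      induction h : τ ω with
      | top => exact ⟨fun h => absurd h.1.2 not_top_lt, fun h => absurd h.2.1 (lt_irrefl _)⟩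
      | coe s =>
        simp only [WithTop.coe_le_coe, WithTop.coe_lt_coe, WithTop.untopD_coe, WithTop.coe_lt_top,
          true_and, q]
        rw [Nat.floor_eq_iff (by positivity), lt_div_iff₀ (by positivity),
          div_le_iff₀ (by positivity), le_div_iff₀ (by positivity), mul_comm s]
        push_cast
        constructor
        · rintro ⟨⟨⟨h1, h2⟩, h3⟩, h4⟩; exact ⟨h1, h4, h3⟩
        · rintro ⟨h1, h4, h3⟩; exact ⟨⟨⟨h1, h3.le⟩, h3⟩, h4⟩
    have hU : A ∩ {ω | τ ω < ⊤} = ⋃ k, B k := by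
      ext ω; simp [hBmem]
    have hdisj : Pairwise (Function.onFun Disjoint B) := fun k l hkl =>
      Set.disjoint_left.mpr fun ω hk hl => hkl (((hBmem k ω).mp hk).2.2.symm.trans
        ((hBmem l ω).mp hl).2.2)
    have hBm' : ∀ k, MeasurableSet (B k) := fun k => ℱ.le _ _ (hBm k)
    rw [hU, integral_iUnion hBm' hdisj, integral_iUnion hBm' hdisj]
    · refine tsum_congr fun k => ?_
      have hv : ∀ ω ∈ B k, dyadicAbove n ((τ ω).untopD 0) = q (k + 1) := fun ω hω => by
        simp [dyadicAbove, ((hBmem k ω).mp hω).2.2, q]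
      rw [setIntegral_congr_fun (g := fun ω => f (X (q (k + 1) + t) ω)) (hBm' k)
          (fun ω hω => by simp only [hv ω hω]), hM _ _ _ (hBm k)]
      exact setIntegral_congr_fun (hBm' k) (fun ω hω => by simp only [hv ω hω])
    · exact Integrable.of_bound (h2m n).aestronglyMeasurable ‖f‖ (.of_forall fun ω => hgb _)
    · exact Integrable.of_bound (h1m n).aestronglyMeasurable ‖f‖
        (.of_forall fun ω => f.norm_coe_le_norm _)
  have L1 := tendsto_integral_of_dominated_convergence (μ := μ.restrict (A ∩ {ω | τ ω < ⊤}))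
    (F := fun n ω => f (X (dyadicAbove n ((τ ω).untopD 0) + t) ω))
    (f := fun ω => f (X ((τ ω).untopD 0 + t) ω)) (fun _ => ‖f‖)
    (fun n => (h1m n).aestronglyMeasurable) (integrable_const _)
    (fun n => .of_forall fun ω => f.norm_coe_le_norm _)
    (.of_forall fun ω => by
      refine (f.continuous.tendsto _).comp ((hr ω _).tendsto.comp ?_)
      have h := tendsto_nhdsWithin_iff.mp (tendsto_dyadicAbove ((τ ω).untopD 0))
      refine tendsto_nhdsWithin_iff.mpr ⟨h.1.add_const t, .of_forall fun n => ?_⟩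
      have := (lt_dyadicAbove n ((τ ω).untopD 0)).le
      simp only [mem_Ici]
      gcongr)
  have L2 := tendsto_integral_of_dominated_convergence (μ := μ.restrict (A ∩ {ω | τ ω < ⊤}))
    (F := fun n ω => ∫ z, f z ∂(P t (X (dyadicAbove n ((τ ω).untopD 0)) ω)))
    (f := fun ω => ∫ z, f z ∂(P t (X ((τ ω).untopD 0) ω))) (fun _ => ‖f‖)
    (fun n => (h2m n).aestronglyMeasurable) (integrable_const _)
    (fun n => .of_forall fun ω => hgb _)
    (.of_forall fun ω =>
      ((hF t f).tendsto _).comp ((hr ω _).tendsto.comp (tendsto_dyadicAbove _)))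
  simp only [key] at L1
  exact tendsto_nhds_unique L1 L2

/-- A right-continuous process with the Markov property with respect to a Feller semigroup has the
strong Markov property. -/
theorem isStrongMarkov_of_feller [SecondCountableTopology S] (hP : ∀ t, IsMarkovKernel (P t))
    (hF : ∀ t (f : S →ᵇ ℝ), Continuous fun x => ∫ z, f z ∂(P t x))
    (hX : ∀ t, Measurable[ℱ t] (X t))
    (hr : ∀ ω t, ContinuousWithinAt (fun s => X s ω) (Ici t) t)
    (hM : ∀ s t A, MeasurableSet[ℱ s] A → ∀ f : S →ᵇ ℝ,
      ∫ ω in A, f (X (s + t) ω) ∂μ = ∫ ω in A, ∫ z, f z ∂(P t (X s ω)) ∂μ) :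
    IsStrongMarkov μ ℱ X P := by
  refine ⟨hX, fun τ hτ t f hf ⟨C, hC⟩ => ?_⟩
  have hXm := measurable_uncurry_of_rightContinuous (fun t => (hX t).mono (ℱ.le t) le_rfl) hr
  have hσ : Measurable fun ω => (τ ω).untopD 0 := hτ.measurable'.untopD 0
  have hXt : Measurable fun ω => X ((τ ω).untopD 0 + t) ω :=
    hXm.comp ((hσ.add_const t).prodMk measurable_id)
  have hX0 : Measurable fun ω => X ((τ ω).untopD 0) ω := hXm.comp (hσ.prodMk measurable_id)
  have hlt : MeasurableSet {ω | τ ω < ⊤} := by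
    have h2 := (hτ.measurable') (measurableSet_Iio (a := (⊤ : WithTop ℝ≥0)))
    exact h2
  have hlt' : MeasurableSet[hτ.measurableSpace] {ω | τ ω < ⊤} :=
    hτ.measurable (measurableSet_Iio (a := (⊤ : WithTop ℝ≥0)))
  have hgm : StronglyMeasurable fun x => ∫ z, f z ∂(P t x) :=
    StronglyMeasurable.integral_kernel_prod_right' (f := fun p : S × S => f p.2)
      (hf.comp measurable_snd).stronglyMeasurable
  have hgb : ∀ x, ‖∫ z, f z ∂(P t x)‖ ≤ C := fun x => by
    have := norm_integral_le_of_norm_le_const (μ := P t x) (f := f) (C := C)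
      (.of_forall fun z => hC z)
    simpa using this
  have key : ∀ A, MeasurableSet[hτ.measurableSpace] A →
      ∫ ω in A ∩ {ω | τ ω < ⊤}, f (X ((τ ω).untopD 0 + t) ω) ∂μ
      = ∫ ω in A ∩ {ω | τ ω < ⊤}, ∫ z, f z ∂(P t (X ((τ ω).untopD 0) ω)) ∂μ := by
    intro A hA
    set D := A ∩ {ω | τ ω < ⊤}
    -- Bounded continuous functions determine a finite measure; this carries the identity over to
    -- bounded Borel functions.
    have hmap : (μ.restrict D).map (fun ω => X ((τ ω).untopD 0 + t) ω)
        = P t ∘ₘ ((μ.restrict D).map fun ω => X ((τ ω).untopD 0) ω) := by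
      refine ext_of_forall_integral_eq_of_IsFiniteMeasure fun g => ?_
      rw [integral_map hXt.aemeasurable g.continuous.measurable.aestronglyMeasurable,
        integral_measure_comp (g.integrable _), integral_map hX0.aemeasurable
          (hF t g).measurable.aestronglyMeasurable]
      exact setIntegral_stopped_eq_of_feller hP hF hX hr hM hτ t hA g
    rw [← integral_map (f := f) hXt.aemeasurable hf.aestronglyMeasurable, hmap,
      integral_measure_comp (Integrable.of_bound hf.aestronglyMeasurable C (.of_forall hC)),
      integral_map hX0.aemeasurable hgm.aestronglyMeasurable]
  symm
  refine ae_eq_condExp_of_forall_setIntegral_eq hτ.measurableSpace_le ?_ (fun A _ _ => ?_)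
    (fun A hA _ => ?_) ?_
  · exact (Integrable.of_bound (hf.comp hXt).aestronglyMeasurable C
      (.of_forall fun ω => hC _)).indicator hlt
  · exact ((Integrable.of_bound (hgm.comp_measurable hX0).aestronglyMeasurable C
      (.of_forall fun ω => hgb _)).indicator hlt).integrableOn
  · rw [setIntegral_indicator hlt, setIntegral_indicator hlt]
    exact (key A hA).symm
  -- The right-hand side must be measurable for the stopped σ-algebra, and this is where progressive
  -- measurability enters.
  · have hsv := measurable_stoppedValue (isStronglyProgressive_of_rightContinuous hX hr) hτ
    have h1 := ((hgm.measurable.comp hsv).indicator hlt').stronglyMeasurable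
    refine StronglyMeasurable.aestronglyMeasurable ?_
    convert h1 using 1
    funext ω
    by_cases h : τ ω < ⊤
    · simp only [indicator_of_mem (show ω ∈ {ω | τ ω < ⊤} from h), Function.comp, stoppedValue]
      lift τ ω to ℝ≥0 using h.ne with s
      rfl
    · simp only [indicator_of_notMem (show ω ∉ {ω | τ ω < ⊤} from h)]

end StrongMarkov

end ZigZag
namespace ZigZag

/-! ### The flow, the survival function and the law of a waiting time -/

/-- The assumptions on the speed and on the switching rate. -/
structure IsAdmissible (a : ℝ) (lam : E → ℝ) : Prop where
  speed_pos : 0 < a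
  continuous : Continuous lam
  nonneg : ∀ x, 0 ≤ lam x
  exists_le : ∃ y₀ : ℝ, 0 ≤ y₀ ∧ ∃ lamMin : ℝ, 0 < lamMin ∧
    ∀ (y : ℝ) (j : ℤˣ), y₀ ≤ sgn j * y → lamMin ≤ lam (y, j)

/-- The state reached from `e` after time `t` without a switch. -/
noncomputable def flow (a t : ℝ) (e : E) : E := (e.1 + a * sgn e.2 * t, e.2)

/-- The state reached from `e` by a switch at time `t`. -/
noncomputable def jump (a t : ℝ) (e : E) : E := (e.1 + a * sgn e.2 * t, -e.2)

lemma continuous_sgn : Continuous sgn := continuous_of_discreteTopology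

lemma sgn_mul_self (j : ℤˣ) : sgn j * sgn j = 1 := by
  rcases Int.units_eq_one_or j with rfl | rfl <;> simp [sgn]

lemma abs_sgn (j : ℤˣ) : |sgn j| = 1 := by
  rcases Int.units_eq_one_or j with rfl | rfl <;> simp [sgn]

lemma continuous_flow (a : ℝ) : Continuous fun p : ℝ × E => flow a p.1 p.2 := by
  have := continuous_sgn
  unfold flow
  fun_prop

lemma continuous_jump (a : ℝ) : Continuous fun p : ℝ × E => jump a p.1 p.2 := by
  have := continuous_sgn
  have h : Continuous fun j : ℤˣ => -j := continuous_of_discreteTopology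
  unfold jump
  fun_prop

@[simp] lemma flow_zero (a : ℝ) (e : E) : flow a 0 e = e := by simp [flow]

lemma flow_flow (a s t : ℝ) (e : E) : flow a t (flow a s e) = flow a (s + t) e := by
  simp only [flow, Prod.mk.injEq, and_true]; ring

lemma jump_flow (a s t : ℝ) (e : E) : jump a t (flow a s e) = jump a (s + t) e := by
  simp only [flow, jump, Prod.mk.injEq, and_true]; ring

variable {a : ℝ} {lam : E → ℝ}

lemma survival_eq (a : ℝ) (lam : E → ℝ) (t : ℝ) (e : E) :
    survival a lam t e = Real.exp (-∫ s in (0 : ℝ)..t, lam (flow a s e)) := rfl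

lemma survival_pos (t : ℝ) (e : E) : 0 < survival a lam t e := Real.exp_pos _

@[simp] lemma survival_zero (e : E) : survival a lam 0 e = 1 := by simp [survival]

namespace IsAdmissible

variable (h : IsAdmissible a lam)
include h

lemma continuous_rate_flow (e : E) : Continuous fun s => lam (flow a s e) :=
  h.continuous.comp ((continuous_flow a).comp (by fun_prop : Continuous fun s : ℝ => (s, e)))

lemma continuous_survival : Continuous fun p : ℝ × E => survival a lam p.1 p.2 := by
  refine Real.continuous_exp.comp (Continuous.neg ?_)
  refine intervalIntegral.continuous_parametric_intervalIntegral_of_continuous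
    (f := fun (p : ℝ × E) s => lam (flow a s p.2)) ?_ continuous_fst
  exact h.continuous.comp ((continuous_flow a).comp
    (by fun_prop : Continuous fun q : (ℝ × E) × ℝ => (q.2, q.1.2)))

/-- The rate is integrated along the flow, and the flow is additive in time. This is the
memorylessness behind the Markov property. -/
lemma survival_add (s t : ℝ) (e : E) :
    survival a lam (s + t) e = survival a lam s e * survival a lam t (flow a s e) := by
  have hi : ∀ x y, IntervalIntegrable (fun s => lam (flow a s e)) volume x y := fun x y =>
    (h.continuous_rate_flow e).intervalIntegrable x y
  rw [survival_eq, survival_eq, survival_eq, ← Real.exp_add,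
    ← intervalIntegral.integral_add_adjacent_intervals (hi 0 s) (hi s (s + t))]
  simp only [flow_flow]
  rw [intervalIntegral.integral_comp_add_left (fun r => lam (flow a r e)), neg_add, add_zero]

lemma survival_le_one {t : ℝ} (ht : 0 ≤ t) (e : E) : survival a lam t e ≤ 1 :=
  Real.exp_le_one_iff.mpr (neg_nonpos.mpr
    (intervalIntegral.integral_nonneg ht fun _ _ => h.nonneg _))

lemma hasDerivAt_survival (t : ℝ) (e : E) :
    HasDerivAt (fun t => survival a lam t e) (-(lam (flow a t e) * survival a lam t e)) t := by
  have h1 := ((h.continuous_rate_flow e).integral_hasStrictDerivAt 0 t).hasDerivAt.neg.exp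
  refine h1.congr_deriv ?_
  rw [survival_eq]; simp only [Pi.neg_apply]; ring

lemma tendsto_survival (e : E) : Tendsto (fun t => survival a lam t e) atTop (𝓝 0) := by
  refine Real.tendsto_exp_neg_atTop_nhds_zero.comp ?_
  obtain ⟨y₀, -, c, hc, hy⟩ := h.exists_le
  have ha := h.speed_pos
  -- Along the flow `j y` grows at speed `a`; from time `s₀` on it is at least `y₀`, and the rate is
  -- at least `c`.
  let s₀ := max 0 ((y₀ - sgn e.2 * e.1) / a)
  have hle : ∀ s, s₀ ≤ s → c ≤ lam (flow a s e) := fun s hs => by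
    refine hy _ _ ?_
    have h1 : (y₀ - sgn e.2 * e.1) / a ≤ s := (le_max_right _ _).trans hs
    rw [div_le_iff₀ ha] at h1
    have h2 := sgn_mul_self e.2
    calc y₀ ≤ sgn e.2 * e.1 + s * a := by linarith
      _ = sgn e.2 * e.1 + (sgn e.2 * sgn e.2) * (s * a) := by rw [h2]; ring
      _ = _ := by ring
  have hi : ∀ x y, IntervalIntegrable (fun s => lam (flow a s e)) volume x y := fun x y =>
    (h.continuous_rate_flow e).intervalIntegrable x y
  refine tendsto_atTop_mono' (f₁ := fun t => (t - s₀) * c) atTop ?_ ?_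
  · filter_upwards [eventually_ge_atTop s₀] with t ht
    calc (t - s₀) * c = ∫ s in s₀..t, c := by simp
      _ ≤ ∫ s in s₀..t, lam (flow a s e) := intervalIntegral.integral_mono_on ht
          (by simp) (hi _ _) fun s hs => hle s hs.1
      _ ≤ (∫ s in (0 : ℝ)..s₀, lam (flow a s e)) + ∫ s in s₀..t, lam (flow a s e) :=
          le_add_of_nonneg_left (intervalIntegral.integral_nonneg (le_max_left _ _)
            fun _ _ => h.nonneg _)
      _ = _ := intervalIntegral.integral_add_adjacent_intervals (hi _ _) (hi _ _)
  · exact (tendsto_atTop_add_const_right _ _ tendsto_id).atTop_mul_const hc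

end IsAdmissible

/-- The density of the first waiting time. -/
noncomputable def waitDensity (a : ℝ) (lam : E → ℝ) (e : E) (s : ℝ) : ℝ :=
  lam (flow a s e) * survival a lam s e

namespace IsAdmissible

variable (h : IsAdmissible a lam)
include h

lemma waitDensity_nonneg (e : E) (s : ℝ) : 0 ≤ waitDensity a lam e s :=
  mul_nonneg (h.nonneg _) (survival_pos _ _).le

lemma continuous_waitDensity : Continuous fun p : E × ℝ => waitDensity a lam p.1 p.2 :=
  (h.continuous.comp ((continuous_flow a).comp continuous_swap)).mul
    (h.continuous_survival.comp continuous_swap)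

lemma waitDensity_add (s t : ℝ) (e : E) :
    waitDensity a lam e (s + t) = survival a lam s e * waitDensity a lam (flow a s e) t := by
  rw [waitDensity, waitDensity, h.survival_add, flow_flow]; ring

/-- The density is minus the derivative of the survival function, which vanishes at infinity;
without that limit some mass would be missing. -/
lemma lintegral_waitDensity_Ioi {t : ℝ} (e : E) :
    ∫⁻ s in Ioi t, ENNReal.ofReal (waitDensity a lam e s) = ENNReal.ofReal (survival a lam t e) := by
  have hd : ∀ x ∈ Ici t, HasDerivAt (fun t => -survival a lam t e) (waitDensity a lam e x) x :=
    fun x _ => by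
      have h1 := (h.hasDerivAt_survival x e).neg
      rw [neg_neg] at h1
      exact h1
  have hlim : Tendsto (fun t => -survival a lam t e) atTop (𝓝 0) := by
    simpa using (h.tendsto_survival e).neg
  have hint := integrableOn_Ioi_deriv_of_nonneg' hd (fun x _ => h.waitDensity_nonneg e x) hlim
  rw [← ofReal_integral_eq_lintegral_ofReal hint (.of_forall fun s => h.waitDensity_nonneg e s),
    integral_Ioi_of_hasDerivAt_of_tendsto' hd hint hlim]
  simp

end IsAdmissible

instance : SigmaFinite ((volume : Measure ℝ).comap ((↑) : Ioi (0 : ℝ) → ℝ)) := by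
  refine SigmaFinite.of_map _ measurable_subtype_coe.aemeasurable ?_
  rw [(MeasurableEmbedding.subtype_coe measurableSet_Ioi).map_comap]
  infer_instance

/-- The law of the first waiting time, as a function of the initial state. -/
noncomputable def waitKernel (a : ℝ) (lam : E → ℝ) : Kernel E (Ioi (0 : ℝ)) :=
  (Kernel.const E ((volume : Measure ℝ).comap ((↑) : Ioi (0 : ℝ) → ℝ))).withDensity
    fun e z => ENNReal.ofReal (waitDensity a lam e z)

namespace IsAdmissible

variable (h : IsAdmissible a lam)
include h

lemma measurable_waitDensity : Measurable (Function.uncurry fun (e : E) (z : Ioi (0 : ℝ)) =>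
    ENNReal.ofReal (waitDensity a lam e z)) :=
  (h.continuous_waitDensity.measurable.comp
    (measurable_fst.prodMk (measurable_subtype_coe.comp measurable_snd))).ennreal_ofReal

lemma lintegral_waitKernel (e : E) {H : ℝ → ENNReal} (hH : Measurable H) :
    ∫⁻ z, H z ∂(waitKernel a lam e)
      = ∫⁻ s in Ioi (0 : ℝ), ENNReal.ofReal (waitDensity a lam e s) * H s := by
  rw [waitKernel, Kernel.lintegral_withDensity _ h.measurable_waitDensity _
    (g := fun z : Ioi (0 : ℝ) => H z) (hH.comp measurable_subtype_coe), Kernel.const_apply]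
  exact lintegral_subtype_comap measurableSet_Ioi
    (fun s => ENNReal.ofReal (waitDensity a lam e s) * H s)

lemma waitKernel_Ioi {t : ℝ} (ht : 0 ≤ t) (e : E) :
    waitKernel a lam e {z | t < (z : ℝ)} = ENNReal.ofReal (survival a lam t e) := by
  have hm : MeasurableSet {z : Ioi (0 : ℝ) | t < (z : ℝ)} :=
    measurableSet_lt measurable_const measurable_subtype_coe
  rw [← lintegral_indicator_one hm]
  have h1 := h.lintegral_waitKernel e (H := (Ioi t).indicator 1)
    (measurable_one.indicator measurableSet_Ioi)
  rw [← h.lintegral_waitDensity_Ioi e]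
  refine Eq.trans ?_ (h1.trans ?_)
  · rfl
  · rw [← lintegral_indicator measurableSet_Ioi, ← lintegral_indicator measurableSet_Ioi]
    refine lintegral_congr fun s => ?_
    simp only [indicator, mem_Ioi]
    by_cases hs : t < s
    · simp [hs, ht.trans_lt hs]
    · simp [hs]

lemma isMarkovKernel_waitKernel : IsMarkovKernel (waitKernel a lam) := by
  refine ⟨fun e => ⟨?_⟩⟩
  have := h.waitKernel_Ioi le_rfl e
  rw [survival_zero, ENNReal.ofReal_one] at this
  rw [← this]
  congr 1
  ext z
  simpa using (show (0 : ℝ) < z from z.2)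

/-- Conditionally on being larger than `s`, the waiting time exceeds `s` by a waiting time for the
state that the flow has reached at time `s`. -/
lemma lintegral_waitKernel_sub {s : ℝ} (hs : 0 ≤ s) (e : E) {H : ℝ → ENNReal}
    (hH : Measurable H) :
    ∫⁻ z, {z : Ioi (0 : ℝ) | s < z}.indicator (fun z => H (z - s)) z ∂(waitKernel a lam e)
      = ENNReal.ofReal (survival a lam s e) * ∫⁻ z, H z ∂(waitKernel a lam (flow a s e)) := by
  have h1 := h.lintegral_waitKernel e (H := (Ioi s).indicator fun z => H (z - s))
    ((hH.comp (measurable_id.sub_const s)).indicator measurableSet_Ioi)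
  refine Eq.trans (lintegral_congr fun z => ?_) (h1.trans ?_)
  · rfl
  -- After translating the integration variable by `s`, `waitDensity_add` splits off the factor
  -- `survival a lam s e`.
  rw [h.lintegral_waitKernel _ hH, ← lintegral_const_mul' _ _ ENNReal.ofReal_ne_top,
    ← lintegral_indicator measurableSet_Ioi, ← lintegral_indicator measurableSet_Ioi,
    ← lintegral_add_left_eq_self _ s]
  refine lintegral_congr fun r => ?_
  simp only [indicator, mem_Ioi, h.waitDensity_add, add_sub_cancel_left, lt_add_iff_pos_right,
    ENNReal.ofReal_mul (survival_pos s e).le]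
  split_ifs <;> first | (simp [mul_assoc]; done) | linarith

end IsAdmissible

end ZigZag
namespace ZigZag

/-! ### The law of the sequence of waiting times -/

/-- The sequence `x, u 0, u 1, …`. -/
def seqCons {X : Type*} (x : X) (u : ℕ → X) : ℕ → X
  | 0 => x
  | n + 1 => u n

section SeqCons

variable {X : Type*}

@[simp] lemma seqCons_zero (x : X) (u : ℕ → X) : seqCons x u 0 = x := rfl

@[simp] lemma seqCons_succ (x : X) (u : ℕ → X) (n : ℕ) : seqCons x u (n + 1) = u n := rfl

lemma measurable_seqCons [MeasurableSpace X] :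
    Measurable fun p : X × (ℕ → X) => seqCons p.1 p.2 := by
  refine measurable_pi_lambda _ fun n => ?_
  cases n with
  | zero => exact measurable_fst
  | succ n => exact (measurable_pi_apply n).comp measurable_snd

/-- The law of an i.i.d. sequence is invariant under adding an independent first term. -/
lemma map_seqCons_infinitePi [MeasurableSpace X] (ν : Measure X) [IsProbabilityMeasure ν] :
    (ν.prod (Measure.infinitePi fun _ : ℕ => ν)).map (fun p => seqCons p.1 p.2)
      = Measure.infinitePi fun _ : ℕ => ν := by
  refine Measure.eq_infinitePi _ fun s t ht => ?_
  classical
  let s' : Finset ℕ := s.preimage Nat.succ Nat.succ_injective.injOn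
  let t₀ : Set X := if 0 ∈ s then t 0 else univ
  have hpre : (fun p : X × (ℕ → X) => seqCons p.1 p.2) ⁻¹' (Set.pi s t)
      = t₀ ×ˢ Set.pi s' fun n => t (n + 1) := by
    ext ⟨x, u⟩
    simp only [mem_preimage, Set.mem_pi, mem_prod, t₀, s', Finset.mem_coe, Finset.mem_preimage]
    constructor
    · intro h
      refine ⟨?_, fun n hn => h _ hn⟩
      split_ifs with h0
      · exact h 0 h0
      · trivial
    · rintro ⟨h0, h1⟩ n hn
      cases n with
      | zero => simpa [hn] using h0
      | succ n => exact h1 n hn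
  rw [Measure.map_apply measurable_seqCons (MeasurableSet.pi s.countable_toSet fun i _ => ht i),
    hpre, Measure.prod_prod, Measure.infinitePi_pi _ fun i _ => ht _]
  have hs' : ∏ i ∈ s', ν (t (i + 1)) = ∏ i ∈ s.erase 0, ν (t i) := by
    refine Finset.prod_bij (fun i _ => i + 1) (fun i hi => ?_) (fun i _ j _ hij => by simpa using hij)
      (fun i hi => ?_) (fun i _ => rfl)
    · simpa [s'] using hi
    · rw [Finset.mem_erase] at hi
      obtain ⟨k, rfl⟩ := Nat.exists_eq_succ_of_ne_zero hi.1
      exact ⟨k, by simpa [s'] using hi.2, rfl⟩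
  rw [hs']
  by_cases h0 : 0 ∈ s
  · simp only [t₀, if_pos h0]
    exact Finset.mul_prod_erase s (fun i => ν (t i)) h0
  · simp [t₀, h0]

end SeqCons

variable {a : ℝ} {lam : E → ℝ}

-- A kernel into a standard Borel space is the law of a measurable function of a uniform variable.
-- This reduces the dependent waiting times to an i.i.d. sequence.
open unitInterval in
lemma IsAdmissible.exists_sampler (h : IsAdmissible a lam) :
    ∃ G : E → I → Ioi (0 : ℝ), Measurable (Function.uncurry G) ∧
      ∀ e, volume.map (G e) = waitKernel a lam e := by
  have := h.isMarkovKernel_waitKernel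
  have : Nonempty (Ioi (0 : ℝ)) := ⟨⟨1, mem_Ioi.mpr one_pos⟩⟩
  have : StandardBorelSpace (Ioi (0 : ℝ)) := measurableSet_Ioi.standardBorel
  exact Kernel.exists_measurable_map_eq_unitInterval (waitKernel a lam)

/-- The state after `n` switches, if the waiting times are sampled by `G` with randomness `u`. -/
noncomputable def sampledState {I : Type*} (a : ℝ) (G : E → I → Ioi (0 : ℝ)) (e : E) (u : ℕ → I) :
    ℕ → E
  | 0 => e
  | n + 1 => jump a (G (sampledState a G e u n) (u n)) (sampledState a G e u n)

/-- The waiting times sampled by `G` with randomness `u`. -/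
noncomputable def sampledTimes {I : Type*} (a : ℝ) (G : E → I → Ioi (0 : ℝ)) (e : E) (u : ℕ → I)
    (n : ℕ) : Ioi (0 : ℝ) := G (sampledState a G e u n) (u n)

section Sampled

variable {I : Type*} {G : E → I → Ioi (0 : ℝ)}

lemma sampledState_seqCons (e : E) (x : I) (u : ℕ → I) (n : ℕ) :
    sampledState a G e (seqCons x u) (n + 1) = sampledState a G (jump a (G e x) e) u n := by
  induction n with
  | zero => rfl
  | succ n ih => rw [sampledState, ih]; rfl

/-- The pathwise form of the first-step decomposition: after the first switch the sampling restarts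
from the new state with the shifted randomness. -/
lemma sampledTimes_seqCons (e : E) (x : I) (u : ℕ → I) :
    sampledTimes a G e (seqCons x u)
      = seqCons (G e x) (sampledTimes a G (jump a (G e x) e) u) := by
  funext n
  cases n with
  | zero => rfl
  | succ n => simp only [sampledTimes, sampledState_seqCons, seqCons_succ]

lemma measurable_sampledTimes [MeasurableSpace I] (hG : Measurable (Function.uncurry G)) :
    Measurable fun p : E × (ℕ → I) => sampledTimes a G p.1 p.2 := by
  have hu : ∀ n, Measurable fun p : E × (ℕ → I) => p.2 n := fun n =>
    (measurable_pi_apply n).comp measurable_snd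
  have hs : ∀ n, Measurable fun p : E × (ℕ → I) => sampledState a G p.1 p.2 n := fun n => by
    induction n with
    | zero => exact measurable_fst
    | succ n ih =>
      exact (continuous_jump a).measurable.comp
        ((measurable_subtype_coe.comp (hG.comp (ih.prodMk (hu n)))).prodMk ih)
  exact measurable_pi_lambda _ fun n => hG.comp ((hs n).prodMk (hu n))

end Sampled

namespace IsAdmissible

variable (h : IsAdmissible a lam)

/-- A map that samples the first waiting time from a uniform random variable. -/
noncomputable def sampler : E → unitInterval → Ioi (0 : ℝ) := h.exists_sampler.choose

lemma measurable_sampler : Measurable (Function.uncurry h.sampler) :=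
  h.exists_sampler.choose_spec.1

lemma map_sampler (e : E) : volume.map (h.sampler e) = waitKernel a lam e :=
  h.exists_sampler.choose_spec.2 e

/-- The law of the waiting times, as a function of the initial state. -/
noncomputable def seqKernel : Kernel E (ℕ → Ioi (0 : ℝ)) :=
  (Kernel.id ×ₖ Kernel.const E (Measure.infinitePi fun _ : ℕ => (volume : Measure unitInterval))).map
    fun p => sampledTimes a h.sampler p.1 p.2

instance : IsMarkovKernel h.seqKernel :=
  Kernel.IsMarkovKernel.map _ (measurable_sampledTimes h.measurable_sampler)

lemma seqKernel_apply (e : E) :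
    h.seqKernel e = (Measure.infinitePi fun _ : ℕ => (volume : Measure unitInterval)).map
      (sampledTimes a h.sampler e) := by
  rw [seqKernel, Kernel.map_apply _ (measurable_sampledTimes h.measurable_sampler),
    Kernel.prod_apply, Kernel.id_apply, Kernel.const_apply, Measure.dirac_prod,
    Measure.map_map (measurable_sampledTimes h.measurable_sampler) measurable_prodMk_left]
  rfl

/-- Split off the first term of the i.i.d. randomness with `map_seqCons_infinitePi`, apply Fubini,
and recognise the restarted sequence by `sampledTimes_seqCons`. -/
lemma lintegral_seqKernel (e : E) {H : (ℕ → Ioi (0 : ℝ)) → ENNReal} (hH : Measurable H) :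
    ∫⁻ z, H z ∂(h.seqKernel e)
      = ∫⁻ x, ∫⁻ z, H (seqCons x z) ∂(h.seqKernel (jump a x e)) ∂(waitKernel a lam e) := by
  have hm := measurable_sampledTimes (a := a) h.measurable_sampler
  have hme : ∀ e, Measurable (sampledTimes a h.sampler e) := fun e =>
    hm.comp measurable_prodMk_left
  have hG : Measurable (h.sampler e) := h.measurable_sampler.comp measurable_prodMk_left
  have hj : Measurable fun x : Ioi (0 : ℝ) => jump a x e :=
    (continuous_jump a).measurable.comp (measurable_subtype_coe.prodMk measurable_const)
  have hin : Measurable fun x : Ioi (0 : ℝ) =>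
      ∫⁻ z, H (seqCons x z) ∂(h.seqKernel (jump a x e)) := by
    have := Measurable.lintegral_kernel_prod_right' (κ := h.seqKernel.comap _ hj)
      (f := fun p => H (seqCons p.1 p.2)) (hH.comp measurable_seqCons)
    simpa [Kernel.comap_apply] using this
  have h1 : Measurable fun u => H (sampledTimes a h.sampler e u) := hH.comp (hme e)
  have h2 : Measurable fun p : unitInterval × (ℕ → unitInterval) =>
      H (sampledTimes a h.sampler e (seqCons p.1 p.2)) := h1.comp measurable_seqCons
  rw [← h.map_sampler e, lintegral_map hin hG, h.seqKernel_apply, lintegral_map hH (hme e),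
    ← map_seqCons_infinitePi, lintegral_map h1 measurable_seqCons, lintegral_prod _ h2.aemeasurable]
  refine lintegral_congr fun x => ?_
  have h3 : Measurable fun z => H (seqCons (h.sampler e x) z) :=
    hH.comp (measurable_seqCons.comp measurable_prodMk_left)
  rw [h.seqKernel_apply, lintegral_map h3 (hme _)]
  simp only [sampledTimes_seqCons]

lemma measurable_jump_coe (a : ℝ) (e : E) : Measurable fun x : Ioi (0 : ℝ) => jump a x e :=
  (continuous_jump a).measurable.comp (measurable_subtype_coe.prodMk measurable_const)

/-- First-step decomposition of the law of the waiting times. -/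
lemma seqKernel_eq_map (e : E) :
    h.seqKernel e = (waitKernel a lam e ⊗ₘ h.seqKernel.comap _ (measurable_jump_coe a e)).map
      (fun p => seqCons p.1 p.2) := by
  have := h.isMarkovKernel_waitKernel
  refine Measure.ext_of_lintegral _ fun H hH => ?_
  have h1 : Measurable fun p : Ioi (0 : ℝ) × (ℕ → Ioi (0 : ℝ)) => H (seqCons p.1 p.2) :=
    hH.comp measurable_seqCons
  rw [h.lintegral_seqKernel e hH, lintegral_map hH measurable_seqCons,
    Measure.lintegral_compProd h1]
  rfl

lemma integral_seqKernel (e : E) {H : (ℕ → Ioi (0 : ℝ)) → ℝ} (hH : Measurable H)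
    {C : ℝ} (hC : ∀ z, |H z| ≤ C) :
    ∫ z, H z ∂(h.seqKernel e)
      = ∫ x, ∫ z, H (seqCons x z) ∂(h.seqKernel (jump a x e)) ∂(waitKernel a lam e) := by
  have := h.isMarkovKernel_waitKernel
  have h1 : Measurable fun p : Ioi (0 : ℝ) × (ℕ → Ioi (0 : ℝ)) => H (seqCons p.1 p.2) :=
    hH.comp measurable_seqCons
  rw [h.seqKernel_eq_map e, integral_map measurable_seqCons.aemeasurable hH.aestronglyMeasurable,
    Measure.integral_compProd (Integrable.of_bound
      h1.aestronglyMeasurable C (.of_forall fun _ => hC _))]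
  rfl

end IsAdmissible

end ZigZag
namespace ZigZag

/-! ### Elementary properties of the paths -/

section Path

variable {a : ℝ} {e : E} {z z' : ℕ → Ioi (0 : ℝ)} {t : ℝ≥0} {n : ℕ}

@[simp] lemma switchTime_zero : switchTime z 0 = 0 := by simp [switchTime]

lemma switchTime_succ : switchTime z (n + 1) = switchTime z n + z n := by
  simp [switchTime, Finset.sum_range_succ]

lemma strictMono_switchTime : StrictMono (switchTime z) :=
  strictMono_nat_of_lt_succ fun n => by
    rw [switchTime_succ]; exact lt_add_of_pos_right _ (z n).2

lemma switchTime_nonneg : 0 ≤ switchTime z n := by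
  rw [← switchTime_zero (z := z)]; exact strictMono_switchTime.monotone (Nat.zero_le n)

lemma switchTime_seqCons (x : Ioi (0 : ℝ)) :
    switchTime (seqCons x z) (n + 1) = x + switchTime z n := by
  simp [switchTime, Finset.sum_range_succ', add_comm]

lemma switchTime_congr (hz : ∀ i < n, z i = z' i) : switchTime z n = switchTime z' n :=
  Finset.sum_congr rfl fun i hi => by rw [hz i (Finset.mem_range.mp hi)]

lemma skeleton_congr (hz : ∀ i < n, z i = z' i) : skeleton a e z n = skeleton a e z' n := by
  induction n with
  | zero => rfl
  | succ n ih => rw [skeleton, skeleton, ih fun i hi => hz i (by lia), hz n (by lia)]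

lemma skeleton_seqCons (x : Ioi (0 : ℝ)) :
    skeleton a e (seqCons x z) (n + 1) = skeleton a (jump a x e) z n := by
  induction n with
  | zero => rfl
  | succ n ih => rw [skeleton, ih]; rfl

/-- The set of the sequences of waiting times with exactly `n` switches up to time `t`. -/
def switchCountSet (n : ℕ) (t : ℝ≥0) : Set (ℕ → Ioi (0 : ℝ)) :=
  {z | switchTime z n ≤ t ∧ (t : ℝ) < switchTime z (n + 1)}

lemma measurableSet_switchCountSet (n : ℕ) (t : ℝ≥0) : MeasurableSet (switchCountSet n t) :=
  (measurableSet_le (measurable_switchTime n) measurable_const).inter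
    (measurableSet_lt measurable_const (measurable_switchTime (n + 1)))

lemma switchCount_eq (h : z ∈ switchCountSet n t) : switchCount z t = n := by
  refine le_antisymm (csSup_le ⟨n, h.1⟩ fun k hk => ?_)
    (le_csSup ⟨n, fun k hk => ?_⟩ h.1)
  all_goals
    have := strictMono_switchTime.lt_iff_lt.mp ((show switchTime z k ≤ t from hk).trans_lt h.2)
    lia

/-- An unbounded set of natural numbers has supremum `0` by default, which is what makes an exploded
path follow the flow from its initial state. -/
lemma switchCount_eq_zero (h : ∀ n, switchTime z n ≤ t) : switchCount z t = 0 := by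
  refine Nat.sSup_of_not_bddAbove fun ⟨N, hN⟩ => ?_
  have := hN (h (N + 1))
  lia

lemma disjoint_switchCountSet (t : ℝ≥0) :
    Pairwise (Function.onFun Disjoint fun n => switchCountSet n t) := fun _ _ hkl =>
  Set.disjoint_left.mpr fun _ hk hl => hkl ((switchCount_eq hk).symm.trans (switchCount_eq hl))

lemma exists_mem_switchCountSet (h : (t : ℝ) < switchTime z n) :
    ∃ k, z ∈ switchCountSet k t := by
  classical
  have hex : ∃ n, (t : ℝ) < switchTime z n := ⟨n, h⟩
  have hpos : Nat.find hex ≠ 0 := fun h0 => by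
    have := Nat.find_spec hex
    rw [h0, switchTime_zero] at this
    exact absurd this (not_lt.mpr t.2)
  obtain ⟨k, hk⟩ := Nat.exists_eq_succ_of_ne_zero hpos
  refine ⟨k, not_lt.mp (Nat.find_min hex (by lia)), ?_⟩
  have := Nat.find_spec hex
  rwa [hk] at this

lemma path_eq (h : z ∈ switchCountSet n t) :
    path a e z t = flow a (t - switchTime z n) (skeleton a e z n) := by
  rw [path, switchCount_eq h]; rfl

lemma path_eq_of_explosion (h : ∀ n, switchTime z n ≤ t) : path a e z t = flow a t e := by
  rw [path, switchCount_eq_zero h, switchTime_zero, sub_zero]; rfl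

/-- Until the first switch the path follows the flow. -/
lemma path_eq_flow (h : (t : ℝ) < z 0) : path a e z t = flow a t e := by
  rw [path_eq (n := 0) ⟨by simp, by simpa [switchTime_succ] using h⟩, switchTime_zero, sub_zero]
  rfl

@[simp] lemma path_zero : path a e z 0 = e := by
  rw [path_eq_flow (show ((0 : ℝ≥0) : ℝ) < z 0 from (z 0).2)]; simp

lemma mem_switchCountSet_seqCons {x : Ioi (0 : ℝ)} {r : ℝ≥0}
    (hr : (r : ℝ) = t - x) :
    seqCons x z ∈ switchCountSet (n + 1) t ↔ z ∈ switchCountSet n r := by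
  simp only [switchCountSet, mem_ofPred_eq, switchTime_seqCons, hr, le_sub_iff_add_le',
    sub_lt_iff_lt_add']

/-- The path after the first switch is the path started in the state at the first switch. -/
lemma path_seqCons {x : Ioi (0 : ℝ)} {r : ℝ≥0} (hr : (r : ℝ) = t - x)
    (hn : (r : ℝ) < switchTime z n) : path a e (seqCons x z) t = path a (jump a x e) z r := by
  -- The hypothesis `hn` cannot be dropped: past an explosion the two sides would follow the flow
  -- from the different states `e` and `jump a x e`.
  obtain ⟨k, hk⟩ := exists_mem_switchCountSet hn
  rw [path_eq hk, path_eq ((mem_switchCountSet_seqCons hr).mpr hk), skeleton_seqCons,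
    switchTime_seqCons, hr]
  congr 1; ring

/-- The path from time `s` on is the path started in the state at time `s`, if there is no switch
up to time `s`. -/
lemma path_seqCons_add {x y : Ioi (0 : ℝ)} {s : ℝ≥0} (hxy : (y : ℝ) = x - s) :
    path a e (seqCons x z) (s + t) = path a (flow a s e) (seqCons y z) t := by
  have hT : ∀ n, switchTime (seqCons x z) (n + 1) = s + switchTime (seqCons y z) (n + 1) := fun n => by
    rw [switchTime_seqCons, switchTime_seqCons, hxy]; ring
  by_cases hex : ∃ n, (t : ℝ) < switchTime (seqCons y z) n
  · obtain ⟨n, hn⟩ := hex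
    obtain ⟨k, hk⟩ := exists_mem_switchCountSet hn
    have hk' : seqCons x z ∈ switchCountSet k (s + t) := by
      refine ⟨?_, ?_⟩
      · cases k with
        | zero => simpa using add_nonneg s.2 t.2
        | succ k => rw [hT]; push_cast; linarith [hk.1]
      · rw [hT]; push_cast; linarith [hk.2]
    rw [path_eq hk, path_eq hk']
    cases k with
    | zero =>
      simp only [skeleton, switchTime_zero, flow_flow, sub_zero, NNReal.coe_add]
    | succ k =>
      rw [skeleton_seqCons, skeleton_seqCons, jump_flow, hT, hxy, add_sub_cancel, NNReal.coe_add,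
        add_sub_add_left_eq_sub]
  -- Here both sides lie on the same flow line past an explosion, so no exclusion is necessary.
  · push Not at hex
    rw [path_eq_of_explosion hex, path_eq_of_explosion, flow_flow]
    · simp
    · intro n
      cases n with
      | zero => simpa using add_nonneg s.2 t.2
      | succ n => rw [hT]; push_cast; linarith [hex (n + 1)]

/-- Just to the right of `t` the path follows a single flow line, even after an explosion. No null
set has to be removed, as `isStrongMarkov_of_feller` requires. -/
lemma path_rightContinuous (a : ℝ) (e : E) (z : ℕ → Ioi (0 : ℝ)) (t : ℝ≥0) :
    ContinuousWithinAt (fun s => path a e z s) (Ici t) t := by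
  have hflow : ∀ (c : ℝ) (x : E), Continuous fun s : ℝ≥0 => flow a (s - c) x := fun c x =>
    (continuous_flow a).comp (by fun_prop : Continuous fun s : ℝ≥0 => ((s : ℝ) - c, x))
  by_cases hex : ∃ n, (t : ℝ) < switchTime z n
  · obtain ⟨n, hn⟩ := hex
    obtain ⟨k, hk⟩ := exists_mem_switchCountSet hn
    have hc := (hflow (switchTime z k) (skeleton a e z k)).continuousWithinAt (s := Ici t) (x := t)
    refine hc.congr_of_eventuallyEq ?_ (path_eq hk)
    have hlt : ∀ᶠ s : ℝ≥0 in 𝓝[≥] t, (s : ℝ) < switchTime z (k + 1) :=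
      nhdsWithin_le_nhds ((NNReal.continuous_coe.tendsto t).eventually (gt_mem_nhds hk.2))
    filter_upwards [hlt, self_mem_nhdsWithin] with s hs hts
    exact path_eq ⟨hk.1.trans (NNReal.coe_le_coe.mpr hts), hs⟩
  · push Not at hex
    have hc := (hflow 0 e).continuousWithinAt (s := Ici t) (x := t)
    simp only [sub_zero] at hc
    exact hc.congr (fun s hs => path_eq_of_explosion fun n =>
      (hex n).trans (NNReal.coe_le_coe.mpr hs)) (path_eq_of_explosion hex)

lemma abs_skeleton_sub_le (ha : 0 ≤ a) (n : ℕ) :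
    |(skeleton a e z n).1 - e.1| ≤ a * switchTime z n := by
  induction n with
  | zero => simp [skeleton]
  | succ n ih =>
    have h1 : |a * sgn (skeleton a e z n).2 * (z n : ℝ)| = a * z n := by
      rw [abs_mul, abs_mul, abs_sgn, abs_of_nonneg ha, abs_of_pos (z n).2, mul_one]
    have h2 : (skeleton a e z (n + 1)).1 - e.1
        = ((skeleton a e z n).1 - e.1) + a * sgn (skeleton a e z n).2 * (z n : ℝ) := by
      simp only [skeleton]; ring
    rw [h2, switchTime_succ, mul_add]
    exact (abs_add_le _ _).trans (by rw [h1]; linarith)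

/-- The position moves at most at speed `a`. -/
lemma abs_path_sub_le (ha : 0 ≤ a) (t : ℝ≥0) : |(path a e z t).1 - e.1| ≤ a * t := by
  set n := switchCount z t
  have hn : switchTime z n ≤ t := by
    by_cases hex : ∃ n, (t : ℝ) < switchTime z n
    · obtain ⟨m, hm⟩ := hex
      obtain ⟨k, hk⟩ := exists_mem_switchCountSet hm
      rw [show n = k from switchCount_eq hk]
      exact hk.1
    · push Not at hex
      exact hex n
  have h1 : |a * sgn (skeleton a e z n).2 * ((t : ℝ) - switchTime z n)|
      = a * (t - switchTime z n) := by
    rw [abs_mul, abs_mul, abs_sgn, abs_of_nonneg ha, abs_of_nonneg (sub_nonneg.mpr hn), mul_one]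
  have h2 : (path a e z t).1 - e.1 = ((skeleton a e z n).1 - e.1)
      + a * sgn (skeleton a e z n).2 * ((t : ℝ) - switchTime z n) := by
    simp only [path, n]; ring
  rw [h2]
  refine (abs_add_le _ _).trans ?_
  rw [h1]
  linarith [abs_skeleton_sub_le (e := e) (z := z) ha n]

end Path

end ZigZag
namespace ZigZag

/-! ### Non-explosion -/

variable {a : ℝ} {lam : E → ℝ}

namespace IsAdmissible

variable (h : IsAdmissible a lam)
include h

lemma exists_rate_le (R : ℝ) : ∃ M, 0 ≤ M ∧ ∀ x : E, |x.1| ≤ R → lam x ≤ M := by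
  obtain ⟨M, hM⟩ := ((isCompact_Icc (a := -R) (b := R)).prod (isCompact_univ (X := ℤˣ))).bddAbove_image
    h.continuous.continuousOn
  refine ⟨max M 0, le_max_right _ _, fun x hx => le_max_of_le_left (hM ⟨x, ⟨?_, mem_univ _⟩, rfl⟩)⟩
  exact abs_le.mp hx

/-- The distance from the origin plus the distance that can be covered in the remaining time does
not increase along the motion. -/
lemma abs_flow_le {R s t : ℝ} {e : E} (he : |e.1| + a * t ≤ R) (hs : 0 ≤ s) :
    |(flow a s e).1| + a * (t - s) ≤ R := by
  have h1 : |a * sgn e.2 * s| = a * s := by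
    rw [abs_mul, abs_mul, abs_sgn, abs_of_pos h.speed_pos, abs_of_nonneg hs, mul_one]
  have h2 := abs_add_le e.1 (a * sgn e.2 * s)
  simp only [flow]
  linarith

/-- As long as the remaining time is nonnegative, all states met satisfy the bound `R`, so the first
waiting time has density at most `M`. Conditioning on it, the induction step integrates `M (M (t -
s))^n / n!` over `s` in `[0, t]`. -/
lemma seqKernel_switchTime_le {M R : ℝ} (hM0 : 0 ≤ M) (hM : ∀ x : E, |x.1| ≤ R → lam x ≤ M)
    (n : ℕ) : ∀ (t : ℝ) (e : E), 0 ≤ t → |e.1| + a * t ≤ R →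
      h.seqKernel e {z | switchTime z n ≤ t} ≤ ENNReal.ofReal ((M * t) ^ n / n.factorial) := by
  induction n with
  | zero => intro t e _ _; simpa using prob_le_one
  | succ n ih =>
    intro t e ht he
    have hms : ∀ (n : ℕ) (t : ℝ), MeasurableSet {z | switchTime z n ≤ t} := fun n t =>
      measurableSet_le (measurable_switchTime n) measurable_const
    have h1 : h.seqKernel e {z | switchTime z (n + 1) ≤ t}
        = ∫⁻ x, h.seqKernel (jump a x e) {z | switchTime z n ≤ t - x} ∂(waitKernel a lam e) := by
      rw [← lintegral_indicator_one (hms _ _), h.lintegral_seqKernel e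
        (measurable_one.indicator (hms _ _))]
      refine lintegral_congr fun x => ?_
      rw [← lintegral_indicator_one (hms _ _)]
      refine lintegral_congr fun z => ?_
      simp only [indicator, mem_ofPred_eq, switchTime_seqCons, le_sub_iff_add_le', Pi.one_apply]
    let g : ℝ → ENNReal := (Iic t).indicator fun s =>
      ENNReal.ofReal ((M * (t - s)) ^ n / n.factorial)
    have hg : Measurable g := Measurable.indicator (by fun_prop) measurableSet_Iic
    have h2 : ∀ x : Ioi (0 : ℝ),
        h.seqKernel (jump a x e) {z | switchTime z n ≤ t - x} ≤ g x := fun x => by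
      have hx0 : (0 : ℝ) < x := x.2
      by_cases hx : (x : ℝ) ≤ t
      · simp only [g, indicator_of_mem (show (x : ℝ) ∈ Iic t from hx)]
        exact ih _ _ (sub_nonneg.mpr hx) (h.abs_flow_le he hx0.le)
      · have : {z : ℕ → Ioi (0 : ℝ) | switchTime z n ≤ t - x} = ∅ := by
          ext z
          simp only [mem_ofPred_eq, mem_empty_iff_false, iff_false, not_le]
          exact lt_of_lt_of_le (by linarith) switchTime_nonneg
        rw [this]; simp
    have h3 : ∀ s ∈ Ioi (0 : ℝ), ENNReal.ofReal (waitDensity a lam e s) * g s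
        ≤ (Ioc 0 t).indicator
          (fun s => ENNReal.ofReal (M * ((M * (t - s)) ^ n / n.factorial))) s := fun s hs => by
      have hs0 : (0 : ℝ) < s := hs
      by_cases hst : s ≤ t
      · simp only [g, indicator_of_mem (show s ∈ Iic t from hst),
          indicator_of_mem (show s ∈ Ioc 0 t from ⟨hs0, hst⟩)]
        rw [← ENNReal.ofReal_mul (h.waitDensity_nonneg e s)]
        have hpos : 0 ≤ (M * (t - s)) ^ n / n.factorial :=
          div_nonneg (pow_nonneg (mul_nonneg hM0 (sub_nonneg.mpr hst)) n) (by positivity)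
        gcongr
        have hRs := h.abs_flow_le he hs0.le
        have has : 0 ≤ a * (t - s) := mul_nonneg h.speed_pos.le (sub_nonneg.mpr hst)
        exact (mul_le_of_le_one_right (h.nonneg _) (h.survival_le_one hs0.le e)).trans
          (hM _ (by linarith))
      · simp [g, hst]
    rw [h1]
    refine (lintegral_mono h2).trans ?_
    rw [h.lintegral_waitKernel e hg]
    refine (setLIntegral_mono' measurableSet_Ioi h3).trans (le_of_eq ?_)
    rw [lintegral_indicator measurableSet_Ioc, Measure.restrict_restrict measurableSet_Ioc,
      inter_eq_left.mpr (fun s hs => hs.1)]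
    have hder : ∀ s ∈ uIcc 0 t, HasDerivAt
        (fun s : ℝ => -((M * (t - s)) ^ (n + 1) / (n + 1).factorial))
        (M * ((M * (t - s)) ^ n / n.factorial)) s := fun s _ => by
      have hd : HasDerivAt (fun s : ℝ => M * (t - s)) (-M) s := by
        simpa using ((hasDerivAt_id s).const_sub t).const_mul M
      refine ((hd.pow (n + 1)).div_const _).neg.congr_deriv ?_
      rw [Nat.factorial_succ]
      push_cast
      field_simp
    have hcont : Continuous fun s : ℝ => M * ((M * (t - s)) ^ n / n.factorial) := by fun_prop
    rw [← ofReal_integral_eq_lintegral_ofReal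
      (hcont.intervalIntegrable 0 t).1
      ((ae_restrict_iff' measurableSet_Ioc).mpr (.of_forall fun s hs =>
        mul_nonneg hM0 (div_nonneg (pow_nonneg (mul_nonneg hM0 (sub_nonneg.mpr hs.2)) n)
          (by positivity)))),
      ← intervalIntegral.integral_of_le ht,
      intervalIntegral.integral_eq_sub_of_hasDerivAt hder (hcont.intervalIntegrable 0 t)]
    simp

/-- Non-explosion of the zig-zag process. -/
lemma ae_tendsto_switchTime (e : E) :
    ∀ᵐ z ∂(h.seqKernel e), Tendsto (switchTime z) atTop atTop := by
  have key : ∀ N : ℕ, ∀ᵐ z ∂(h.seqKernel e), ∃ n, (N : ℝ) < switchTime z n := fun N => by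
    obtain ⟨M, hM0, hM⟩ := h.exists_rate_le (|e.1| + a * N)
    have hle := fun n => h.seqKernel_switchTime_le hM0 hM n N e (by positivity) le_rfl
    have hlim : Tendsto (fun n : ℕ => ENNReal.ofReal ((M * N) ^ n / n.factorial)) atTop (𝓝 0) := by
      simpa using ENNReal.tendsto_ofReal (FloorSemiring.tendsto_pow_div_factorial_atTop (M * N))
    rw [ae_iff]
    refine le_antisymm (ge_of_tendsto' hlim fun n => (measure_mono fun z hz => ?_).trans (hle n))
      bot_le
    simp only [not_exists, not_lt, mem_ofPred_eq] at hz ⊢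
    exact hz n
  filter_upwards [ae_all_iff.mpr key] with z hz
  refine tendsto_atTop_atTop_of_monotone strictMono_switchTime.monotone fun b => ?_
  obtain ⟨N, hN⟩ := exists_nat_ge b
  obtain ⟨n, hn⟩ := hz N
  exact ⟨n, hN.trans hn.le⟩

lemma ae_exists_lt_switchTime (e : E) (t : ℝ) :
    ∀ᵐ z ∂(h.seqKernel e), ∃ n, t < switchTime z n := by
  filter_upwards [h.ae_tendsto_switchTime e] with z hz
  exact (hz.eventually_gt_atTop t).exists

end IsAdmissible

/-! ### The transition semigroup and the Markov property -/

lemma measurable_path_prod (a : ℝ) (t : ℝ≥0) :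
    Measurable fun p : E × (ℕ → Ioi (0 : ℝ)) => path a p.1 p.2 t := by
  have hsk : ∀ n, Measurable fun p : E × (ℕ → Ioi (0 : ℝ)) => skeleton a p.1 p.2 n := fun n => by
    induction n with
    | zero => exact measurable_fst
    | succ n ih => exact (continuous_jump a).measurable.comp ((measurable_subtype_coe.comp
        ((measurable_pi_apply n).comp measurable_snd)).prodMk ih)
  have key : ∀ n, Measurable fun p : E × (ℕ → Ioi (0 : ℝ)) =>
      flow a (t - switchTime p.2 n) (skeleton a p.1 p.2 n) := fun n =>
    (continuous_flow a).measurable.comp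
      ((((measurable_switchTime n).comp measurable_snd).const_sub _).prodMk (hsk n))
  have h2 : Measurable fun q : (E × (ℕ → Ioi (0 : ℝ))) × ℕ =>
      flow a (t - switchTime q.1.2 q.2) (skeleton a q.1.1 q.1.2 q.2) :=
    measurable_from_prod_countable_left key
  exact h2.comp (measurable_id.prodMk ((measurable_switchCount t).comp measurable_snd))

lemma measurable_comp_path {β : Type*} [MeasurableSpace β] (a : ℝ) (t : ℝ≥0) (e : E) {f : E → β}
    (hf : Measurable f) : Measurable fun z : ℕ → Ioi (0 : ℝ) => f (path a e z t) :=
  hf.comp (measurable_path a e t)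

/-- A set of sequences of waiting times is determined at time `s` if membership depends only on
the number of switches up to time `s` and on the waiting times before them. -/
def IsDetermined (s : ℝ≥0) (A : Set (ℕ → Ioi (0 : ℝ))) : Prop :=
  ∀ n z z', (∀ i < n, z i = z' i) → z ∈ switchCountSet n s → z' ∈ switchCountSet n s →
    z ∈ A → z' ∈ A

lemma IsDetermined.compl {s : ℝ≥0} {A : Set (ℕ → Ioi (0 : ℝ))} (hA : IsDetermined s A) :
    IsDetermined s Aᶜ := fun n z z' hz h1 h2 h3 h4 =>
  h3 (hA n z' z (fun i hi => (hz i hi).symm) h2 h1 h4)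

lemma IsDetermined.iUnion {s : ℝ≥0} {A : ℕ → Set (ℕ → Ioi (0 : ℝ))}
    (hA : ∀ k, IsDetermined s (A k)) : IsDetermined s (⋃ k, A k) := fun n z z' hz h1 h2 h3 => by
  obtain ⟨k, hk⟩ := mem_iUnion.mp h3
  exact mem_iUnion.mpr ⟨k, hA k n z z' hz h1 h2 hk⟩

lemma isDetermined_path (a : ℝ) (e : E) {r s : ℝ≥0} (hrs : r ≤ s) (B : Set E) :
    IsDetermined s {z | path a e z r ∈ B} := by
  intro n z z' hz h1 h2 h3
  have hrs' : (r : ℝ) ≤ s := hrs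
  obtain ⟨k, hk⟩ := exists_mem_switchCountSet (hrs'.trans_lt h1.2)
  have hkn : k ≤ n := by
    have := strictMono_switchTime.lt_iff_lt.mp ((hk.1.trans hrs').trans_lt h1.2)
    lia
  have hzk : ∀ i < k, z i = z' i := fun i hi => hz i (by lia)
  have hk' : z' ∈ switchCountSet k r := by
    refine ⟨switchTime_congr hzk ▸ hk.1, ?_⟩
    -- If `k = n`, the next waiting time is not shared by `z` and `z'`; the bound comes from `s <
    -- switchTime z' (n + 1)` instead.
    rcases hkn.lt_or_eq with hlt | rfl
    · rw [← switchTime_congr (n := k + 1) fun i hi => hz i (by lia)]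
      exact hk.2
    · exact hrs'.trans_lt h2.2
  simp only [mem_ofPred_eq, path_eq hk, path_eq hk'] at h3 ⊢
  rwa [← switchTime_congr hzk, ← skeleton_congr hzk]

lemma IsDetermined.seqCons {s r : ℝ≥0} {A : Set (ℕ → Ioi (0 : ℝ))} (hA : IsDetermined s A)
    {x : Ioi (0 : ℝ)} (hr : (r : ℝ) = s - x) :
    IsDetermined r {z | seqCons x z ∈ A} := by
  intro n z z' hz h1 h2 h3
  refine hA (n + 1) _ _ (fun i hi => ?_) ((mem_switchCountSet_seqCons hr).mpr h1)
    ((mem_switchCountSet_seqCons hr).mpr h2) h3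
  cases i with
  | zero => rfl
  | succ i => exact hz i (by lia)

namespace IsAdmissible

variable (h : IsAdmissible a lam)

/-- The transition semigroup of the zig-zag process. -/
noncomputable def semigroup (t : ℝ≥0) : Kernel E E :=
  (Kernel.id ×ₖ h.seqKernel).map fun p => path a p.1 p.2 t

instance (t : ℝ≥0) : IsMarkovKernel (h.semigroup t) :=
  Kernel.IsMarkovKernel.map _ (measurable_path_prod a t)

lemma semigroup_apply (t : ℝ≥0) (e : E) :
    h.semigroup t e = (h.seqKernel e).map fun z => path a e z t := by
  rw [semigroup, Kernel.map_apply _ (measurable_path_prod a t), Kernel.prod_apply,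
    Kernel.id_apply, Measure.dirac_prod,
    Measure.map_map (measurable_path_prod a t) measurable_prodMk_left]
  rfl

lemma lintegral_semigroup (t : ℝ≥0) (e : E) {f : E → ENNReal} (hf : Measurable f) :
    ∫⁻ y, f y ∂(h.semigroup t e) = ∫⁻ z, f (path a e z t) ∂(h.seqKernel e) := by
  rw [semigroup_apply, lintegral_map hf (measurable_path a e t)]

/-- Given that the first switch is later than `s`, the residual waiting time is a fresh waiting time
for the state on the flow at `s`, and the switch leads to the same state (`jump_flow`). -/
lemma lintegral_path_first_switch_gt (s t : ℝ≥0) (e : E) {f : E → ENNReal} (hf : Measurable f) :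
    ∫⁻ z, {z : ℕ → Ioi (0 : ℝ) | (s : ℝ) < z 0}.indicator (fun z => f (path a e z (s + t))) z
        ∂(h.seqKernel e)
      = ENNReal.ofReal (survival a lam s e) * ∫⁻ y, f y ∂(h.semigroup t (flow a s e)) := by
  have hset : MeasurableSet {z : ℕ → Ioi (0 : ℝ) | (s : ℝ) < z 0} :=
    measurableSet_lt measurable_const (measurable_subtype_coe.comp (measurable_pi_apply 0))
  have hm : Measurable fun z => f (path a (flow a s e) z t) := hf.comp (measurable_path a _ t)
  let H₀ : Ioi (0 : ℝ) → ENNReal := fun x =>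
    ∫⁻ z, f (path a (flow a s e) (seqCons x z) t) ∂(h.seqKernel (jump a x (flow a s e)))
  have hH₀ : Measurable H₀ := by
    have := Measurable.lintegral_kernel_prod_right'
      (κ := h.seqKernel.comap _ (measurable_jump_coe a (flow a s e)))
      (f := fun p => f (path a (flow a s e) (seqCons p.1 p.2) t)) (hm.comp measurable_seqCons)
    simpa [Kernel.comap_apply] using this
  -- `lintegral_waitKernel_sub` asks for a function on all of `ℝ`; the values of the extension
  -- outside `(0, ∞)` are irrelevant, since only `z - s > 0` counts.
  obtain ⟨H, hH, hHH⟩ :=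
    (MeasurableEmbedding.subtype_coe measurableSet_Ioi).exists_measurable_extend hH₀ fun _ => ⟨0⟩
  have hHx : ∀ x : Ioi (0 : ℝ), H x = H₀ x := fun x => congrFun hHH x
  rw [h.lintegral_seqKernel e ((measurable_comp_path a (s + t) e hf).indicator hset),
    h.lintegral_semigroup t _ hf, h.lintegral_seqKernel _ hm]
  have h1 := h.lintegral_waitKernel_sub s.coe_nonneg e hH
  simp only [hHx] at h1
  refine Eq.trans (lintegral_congr fun x => ?_) h1
  by_cases hx : (s : ℝ) < x
  · have hy : (0 : ℝ) < x - s := sub_pos.mpr hx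
    have h2 := hHx ⟨x - s, hy⟩
    simp only [indicator, mem_ofPred_eq, seqCons_zero, hx, if_true]
    rw [show H ((x : ℝ) - (s : ℝ)) = _ from h2]
    simp only [H₀, jump_flow, add_sub_cancel]
    refine lintegral_congr fun z => ?_
    rw [path_seqCons_add (y := ⟨x - s, hy⟩) rfl]
  · simp [indicator, hx]

/-- The Markov property at time `s` on the event that there are `n` switches up to time `s`. -/
lemma lintegral_path_add_of_switchCount (n : ℕ) : ∀ (s : ℝ≥0) (e : E) (A : Set (ℕ → Ioi (0 : ℝ))),
    MeasurableSet A → IsDetermined s A → ∀ (t : ℝ≥0) (f : E → ENNReal), Measurable f →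
    ∫⁻ z, (A ∩ switchCountSet n s).indicator (fun z => f (path a e z (s + t))) z ∂(h.seqKernel e)
      = ∫⁻ z, (A ∩ switchCountSet n s).indicator
          (fun z => ∫⁻ y, f y ∂(h.semigroup t (path a e z s))) z ∂(h.seqKernel e) := by
  induction n with
  | zero =>
    intro s e A hA hAs t f hf
    have hset : switchCountSet 0 s = {z : ℕ → Ioi (0 : ℝ) | (s : ℝ) < z 0} := by
      ext z; simp [switchCountSet, switchTime_succ]
    -- With no switch up to `s` there is nothing to distinguish sequences, so a determined set
    -- contains all of `{s < z 0}` or none of it.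
    rcases (A ∩ switchCountSet 0 s).eq_empty_or_nonempty with hemp | ⟨z₀, hz₀A, hz₀⟩
    · simp [hemp]
    have hinter : A ∩ switchCountSet 0 s = {z : ℕ → Ioi (0 : ℝ) | (s : ℝ) < z 0} := by
      rw [← hset, inter_eq_right]
      exact fun z hz => hAs 0 z₀ z (by simp) hz₀ hz hz₀A
    rw [hinter, h.lintegral_path_first_switch_gt s t e hf]
    -- The right-hand side is the same formula for `P_t f` in place of `f` and time increment `0`.
    have h1 := h.lintegral_path_first_switch_gt s 0 e
      (f := fun y => ∫⁻ y', f y' ∂(h.semigroup t y)) hf.lintegral_kernel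
    rw [h.lintegral_semigroup 0 _ hf.lintegral_kernel] at h1
    simpa using h1.symm
  | succ n ih =>
    intro s e A hA hAs t f hf
    have hset : MeasurableSet (A ∩ switchCountSet (n + 1) s) :=
      hA.inter (measurableSet_switchCountSet _ _)
    rw [h.lintegral_seqKernel e ((measurable_comp_path a (s + t) e hf).indicator hset),
      h.lintegral_seqKernel e
        ((measurable_comp_path a s e hf.lintegral_kernel).indicator hset)]
    refine lintegral_congr fun x => ?_
    by_cases hx : (x : ℝ) ≤ s
    · let r : ℝ≥0 := ⟨s - x, sub_nonneg.mpr hx⟩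
      have hr : (r : ℝ) = s - x := rfl
      have hmem : ∀ z, seqCons x z ∈ A ∩ switchCountSet (n + 1) s
          ↔ z ∈ {z | seqCons x z ∈ A} ∩ switchCountSet n r := fun z =>
        and_congr Iff.rfl (mem_switchCountSet_seqCons hr)
      have hAx : MeasurableSet {z | seqCons x z ∈ A} :=
        (measurable_seqCons.comp measurable_prodMk_left) hA
      have h1 := ih r (jump a x e) _ hAx (hAs.seqCons hr) t f hf
      refine Eq.trans (lintegral_congr_ae ?_) (h1.trans (lintegral_congr fun z => ?_))
      -- Restarting the path at the first switch is valid only before an explosion, hence almost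
      -- everywhere.
      · filter_upwards [h.ae_exists_lt_switchTime (jump a x e) ((r + t : ℝ≥0) : ℝ)] with z ⟨m, hm⟩
        have hrt : ((r + t : ℝ≥0) : ℝ) = ((s + t : ℝ≥0) : ℝ) - x := by
          push_cast; rw [hr]; ring
        by_cases hz : z ∈ {z | seqCons x z ∈ A} ∩ switchCountSet n r
        · rw [indicator_of_mem ((hmem z).mpr hz), indicator_of_mem hz, path_seqCons hrt hm]
        · rw [indicator_of_notMem (mt (hmem z).mp hz), indicator_of_notMem hz]
      · by_cases hz : z ∈ {z | seqCons x z ∈ A} ∩ switchCountSet n r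
        · rw [indicator_of_mem ((hmem z).mpr hz), indicator_of_mem hz, path_seqCons hr hz.2.2]
        · rw [indicator_of_notMem (mt (hmem z).mp hz), indicator_of_notMem hz]
    · have hnot : ∀ z, seqCons x z ∉ A ∩ switchCountSet (n + 1) s := fun z hz => by
        have := hz.2.1
        rw [switchTime_seqCons] at this
        linarith [switchTime_nonneg (z := z) (n := n)]
      simp [indicator, hnot]

/-- The Markov property of the paths. -/
lemma setLIntegral_path_add (s t : ℝ≥0) (e : E) {A : Set (ℕ → Ioi (0 : ℝ))} (hA : MeasurableSet A)
    (hAs : IsDetermined s A) {f : E → ENNReal} (hf : Measurable f) :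
    ∫⁻ z in A, f (path a e z (s + t)) ∂(h.seqKernel e)
      = ∫⁻ z in A, ∫⁻ y, f y ∂(h.semigroup t (path a e z s)) ∂(h.seqKernel e) := by
  have hae : A =ᵐ[h.seqKernel e] ⋃ n, A ∩ switchCountSet n s := by
    filter_upwards [h.ae_exists_lt_switchTime e s] with z ⟨n, hn⟩
    obtain ⟨k, hk⟩ := exists_mem_switchCountSet hn
    refine propext ⟨fun hz => mem_iUnion.mpr ⟨k, hz, hk⟩, fun hz => ?_⟩
    obtain ⟨k, hk⟩ := mem_iUnion.mp hz
    exact hk.1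
  have hm : ∀ n, MeasurableSet (A ∩ switchCountSet n s) := fun n =>
    hA.inter (measurableSet_switchCountSet _ _)
  have hd : Pairwise (Function.onFun Disjoint fun n => A ∩ switchCountSet n s) := fun k l hkl =>
    (disjoint_switchCountSet s hkl).mono inter_subset_right inter_subset_right
  rw [setLIntegral_congr hae, setLIntegral_congr hae, lintegral_iUnion hm hd,
    lintegral_iUnion hm hd]
  refine tsum_congr fun n => ?_
  rw [← lintegral_indicator (hm n), ← lintegral_indicator (hm n)]
  exact h.lintegral_path_add_of_switchCount n s e A hA hAs t f hf

theorem isMarkovSemigroup : IsMarkovSemigroup h.semigroup where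
  isMarkovKernel t := inferInstance
  zero := by
    ext1 e
    rw [semigroup_apply, Kernel.id_apply]
    simp
  add s t := by
    ext1 e
    refine Measure.ext_of_lintegral _ fun f hf => ?_
    rw [Kernel.lintegral_comp _ _ _ hf, h.lintegral_semigroup _ _ hf,
      h.lintegral_semigroup _ _ hf.lintegral_kernel]
    have := h.setLIntegral_path_add s t e (A := univ) MeasurableSet.univ
      (fun _ _ _ _ _ _ _ => mem_univ _) hf
    simpa only [Measure.restrict_univ] using this

end IsAdmissible

end ZigZag
namespace ZigZag

/-! ### Existence and uniqueness in law of the waiting times -/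

/-- A version of a conditional probability is characterised by its integrals. -/
lemma condProb_ae_eq_iff {Ω : Type*} {m m₀ : MeasurableSpace Ω} (hm : m ≤ m₀) {μ : Measure Ω}
    [IsProbabilityMeasure μ] {S : Set Ω} (hS : MeasurableSet S) {g : Ω → ℝ}
    (hg : Measurable[m] g) (hg0 : ∀ ω, 0 ≤ g ω) (hg1 : ∀ ω, g ω ≤ 1) :
    μ⟦S|m⟧ =ᵐ[μ] g ↔
      ∀ A, MeasurableSet[m] A → μ (A ∩ S) = ∫⁻ ω in A, ENNReal.ofReal (g ω) ∂μ := by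
  have hgi : Integrable g μ := Integrable.of_bound (hg.mono hm le_rfl).aestronglyMeasurable 1
    (.of_forall fun ω => by rw [Real.norm_eq_abs, abs_of_nonneg (hg0 ω)]; exact hg1 ω)
  have hSi : Integrable (S.indicator fun _ => (1 : ℝ)) μ := (integrable_const 1).indicator hS
  have h1 : ∀ A, MeasurableSet A →
      ∫ ω in A, S.indicator (fun _ => (1 : ℝ)) ω ∂μ = μ.real (A ∩ S) := fun A hA => by
    rw [setIntegral_indicator hS, setIntegral_const, smul_eq_mul, mul_one]
  have h2 : ∀ A, ENNReal.ofReal (∫ ω in A, g ω ∂μ) = ∫⁻ ω in A, ENNReal.ofReal (g ω) ∂μ := fun A =>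
    ofReal_integral_eq_lintegral_ofReal hgi.integrableOn (.of_forall hg0)
  constructor
  · intro h A hA
    rw [← h2, ← setIntegral_congr_ae (hm _ hA) (h.mono fun ω hω _ => hω),
      setIntegral_condExp hm hSi hA, h1 A (hm _ hA), ofReal_measureReal]
  · intro h
    refine (ae_eq_condExp_of_forall_setIntegral_eq hm hSi (fun _ _ _ => hgi.integrableOn)
      (fun A hA _ => ?_) hg.stronglyMeasurable.aestronglyMeasurable).symm
    rw [h1 A (hm _ hA), measureReal_def, h A hA, ← h2, ENNReal.toReal_ofReal]
    exact integral_nonneg hg0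

/-- The first `n` terms of a sequence. -/
def prefixMap {X : Type*} (n : ℕ) (z : ℕ → X) : Fin n → X := fun k => z k

/-- A sequence with prescribed first `n` terms. -/
noncomputable def extendSeq {n : ℕ} (p : Fin n → Ioi (0 : ℝ)) (k : ℕ) : Ioi (0 : ℝ) :=
  if hk : k < n then p ⟨k, hk⟩ else ⟨1, mem_Ioi.mpr one_pos⟩

lemma measurable_prefixMap {X : Type*} [MeasurableSpace X] (n : ℕ) :
    Measurable (prefixMap (X := X) n) :=
  measurable_pi_lambda _ fun _ => measurable_pi_apply _

lemma measurable_extendSeq {n : ℕ} : Measurable (extendSeq (n := n)) := by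
  refine measurable_pi_lambda _ fun k => ?_
  unfold extendSeq
  split_ifs with hk
  · exact measurable_pi_apply _
  · exact measurable_const

/-- The state after `n` switches factors through the first `n` waiting times, so it is measurable
for the σ-algebra they generate; the filler value `1` is never read. -/
lemma skeleton_extendSeq (a : ℝ) (e : E) (n : ℕ) (z : ℕ → Ioi (0 : ℝ)) :
    skeleton a e (extendSeq (prefixMap n z)) n = skeleton a e z n :=
  skeleton_congr fun i hi => by simp [extendSeq, hi, prefixMap]

lemma iSup_comap_eq_comap_prefixMap {Ω X : Type*} [MeasurableSpace X] (Z : ℕ → Ω → X) (n : ℕ) :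
    (⨆ k : Fin n, MeasurableSpace.comap (Z k) inferInstance)
      = MeasurableSpace.comap (fun ω => prefixMap n fun k => Z k ω) MeasurableSpace.pi := by
  simp only [MeasurableSpace.pi, MeasurableSpace.comap_iSup, MeasurableSpace.comap_comp]
  rfl

variable {a : ℝ} {lam : E → ℝ}

/-- The law of a sequence of waiting times, characterised without conditional probabilities. -/
def IsWaitingLaw (a : ℝ) (lam : E → ℝ) (e : E) (ν : Measure (ℕ → Ioi (0 : ℝ))) : Prop :=
  ∀ (n : ℕ) (t : ℝ), 0 ≤ t → ∀ B : Set (Fin n → Ioi (0 : ℝ)), MeasurableSet B →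
    ν (prefixMap n ⁻¹' B ∩ {z | t < (z n : ℝ)})
      = ∫⁻ z in prefixMap n ⁻¹' B, ENNReal.ofReal (survival a lam t (skeleton a e z n)) ∂ν

lemma measurableSet_lt_apply (t : ℝ) (n : ℕ) :
    MeasurableSet {z : ℕ → Ioi (0 : ℝ) | t < (z n : ℝ)} :=
  measurableSet_lt measurable_const (measurable_subtype_coe.comp (measurable_pi_apply n))

namespace IsAdmissible

variable (h : IsAdmissible a lam)
include h

lemma measurable_survival (t : ℝ) : Measurable fun e => survival a lam t e :=
  h.continuous_survival.measurable.comp measurable_prodMk_left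

lemma measurable_survival_skeleton (t : ℝ) (e : E) (n : ℕ) :
    Measurable fun z => survival a lam t (skeleton a e z n) :=
  (h.measurable_survival t).comp (measurable_skeleton a e n)

/-- The conditioning events are exactly the preimages of measurable sets of prefixes, so the
condition depends on the joint law alone. -/
lemma isWaitingTimes_iff {Ω : Type*} [MeasurableSpace Ω] {μ : Measure Ω}
    {Z : ℕ → Ω → Ioi (0 : ℝ)} {e : E} (hμ : IsProbabilityMeasure μ) (hZ : ∀ n, Measurable (Z n)) :
    IsWaitingTimes a lam e μ Z ↔ IsWaitingLaw a lam e (μ.map fun ω k => Z k ω) := by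
  have hZ' : Measurable fun ω k => Z k ω := measurable_pi_lambda _ hZ
  have hle : ∀ n, (⨆ k : Fin n, MeasurableSpace.comap (Z k) inferInstance) ≤ ‹MeasurableSpace Ω› :=
    fun n => iSup_le fun k => (hZ k).comap_le
  have hmeas : ∀ n t, Measurable[⨆ k : Fin n, MeasurableSpace.comap (Z k) inferInstance]
      fun ω => survival a lam t (skeleton a e (fun k => Z k ω) n) := fun n t => by
    rw [iSup_comap_eq_comap_prefixMap]
    have h1 : Measurable fun p : Fin n → Ioi (0 : ℝ) =>
        survival a lam t (skeleton a e (extendSeq p) n) :=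
      (h.measurable_survival_skeleton t e n).comp measurable_extendSeq
    have h2 := h1.comp (comap_measurable fun ω => prefixMap n fun k => Z k ω)
    simpa only [Function.comp_def, skeleton_extendSeq] using h2
  have key : ∀ n t, 0 ≤ t →
      ((μ⟦{ω | t < (Z n ω : ℝ)} | ⨆ k : Fin n, MeasurableSpace.comap (Z k) inferInstance⟧
        =ᵐ[μ] fun ω => survival a lam t (skeleton a e (fun k => Z k ω) n)) ↔
      ∀ B : Set (Fin n → Ioi (0 : ℝ)), MeasurableSet B →
        (μ.map fun ω k => Z k ω) (prefixMap n ⁻¹' B ∩ {z | t < (z n : ℝ)})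
        = ∫⁻ z in prefixMap n ⁻¹' B, ENNReal.ofReal (survival a lam t (skeleton a e z n))
          ∂(μ.map fun ω k => Z k ω)) := fun n t ht => by
    have hS : MeasurableSet {ω | t < (Z n ω : ℝ)} :=
      measurableSet_lt measurable_const (measurable_subtype_coe.comp (hZ n))
    rw [condProb_ae_eq_iff (hle n) hS (hmeas n t) (fun ω => (survival_pos _ _).le)
      (fun ω => h.survival_le_one ht _)]
    have hB : ∀ B : Set (Fin n → Ioi (0 : ℝ)), MeasurableSet B →
        (((μ.map fun ω k => Z k ω) (prefixMap n ⁻¹' B ∩ {z | t < (z n : ℝ)})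
          = ∫⁻ z in prefixMap n ⁻¹' B, ENNReal.ofReal (survival a lam t (skeleton a e z n))
            ∂(μ.map fun ω k => Z k ω)) ↔
        μ ((fun ω => prefixMap n fun k => Z k ω) ⁻¹' B ∩ {ω | t < (Z n ω : ℝ)})
          = ∫⁻ ω in (fun ω => prefixMap n fun k => Z k ω) ⁻¹' B,
            ENNReal.ofReal (survival a lam t (skeleton a e (fun k => Z k ω) n)) ∂μ) := fun B hB => by
      rw [Measure.map_apply hZ' ((measurable_prefixMap n hB).inter (measurableSet_lt_apply t n)),
        setLIntegral_map (measurable_prefixMap n hB)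
          (h.measurable_survival_skeleton t e n).ennreal_ofReal hZ']
      rfl
    constructor
    · intro hA B hBm
      refine (hB B hBm).mpr (hA _ ?_)
      rw [iSup_comap_eq_comap_prefixMap]
      exact ⟨B, hBm, rfl⟩
    · intro hB' A hA
      rw [iSup_comap_eq_comap_prefixMap] at hA
      obtain ⟨B, hBm, rfl⟩ := hA
      exact (hB B hBm).mp (hB' B hBm)
  constructor
  · intro hw n t ht
    exact (key n t ht).mp (hw.condProb n t ht)
  · intro hw
    exact ⟨hμ, hZ, fun n t ht => (key n t ht).mpr (hw n t ht)⟩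

/-- Fixing the first waiting time turns an event in the first `n + 1` terms into one in the first
`n` terms for the restarted sequence; at `n = 0` only the tail of `waitKernel` remains. -/
lemma lintegral_indicator_survival_skeleton {t : ℝ} (ht : 0 ≤ t) (n : ℕ) :
    ∀ (e : E) (A : Set (ℕ → Ioi (0 : ℝ))), MeasurableSet A →
    (∀ z z', (∀ i < n, z i = z' i) → z ∈ A → z' ∈ A) →
    ∫⁻ z, (A ∩ {z | t < (z n : ℝ)}).indicator 1 z ∂(h.seqKernel e)
      = ∫⁻ z, A.indicator (fun z => ENNReal.ofReal (survival a lam t (skeleton a e z n))) z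
        ∂(h.seqKernel e) := by
  induction n with
  | zero =>
    intro e A hA hAn
    rcases A.eq_empty_or_nonempty with rfl | ⟨z₀, hz₀⟩
    · simp
    obtain rfl : A = univ := eq_univ_of_forall fun z => hAn z₀ z (by simp) hz₀
    rw [h.lintegral_seqKernel e (measurable_one.indicator (hA.inter (measurableSet_lt_apply t 0)))]
    simp only [indicator_univ, skeleton, lintegral_const, measure_univ, mul_one]
    rw [← h.waitKernel_Ioi ht e, ← lintegral_indicator_one
      (measurableSet_lt measurable_const measurable_subtype_coe)]
    refine lintegral_congr fun x => ?_
    by_cases hx : t < (x : ℝ) <;> simp [indicator, hx]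
  | succ n ih =>
    intro e A hA hAn
    rw [h.lintegral_seqKernel e
        (measurable_one.indicator (hA.inter (measurableSet_lt_apply t (n + 1)))),
      h.lintegral_seqKernel e
        ((h.measurable_survival_skeleton t e (n + 1)).ennreal_ofReal.indicator hA)]
    refine lintegral_congr fun x => ?_
    have h1 := ih (jump a x e) {z | seqCons x z ∈ A}
      ((measurable_seqCons.comp measurable_prodMk_left) hA) fun z z' hz hzA => by
        refine hAn _ _ (fun i hi => ?_) hzA
        cases i with
        | zero => rfl
        | succ i => exact hz i (by lia)
    refine Eq.trans (lintegral_congr fun z => ?_) (h1.trans (lintegral_congr fun z => ?_))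
    · rfl
    · simp only [indicator, mem_ofPred_eq, skeleton_seqCons]

lemma isWaitingLaw_seqKernel (e : E) : IsWaitingLaw a lam e (h.seqKernel e) := by
  intro n t ht B hB
  have hA := measurable_prefixMap (X := Ioi (0 : ℝ)) n hB
  rw [← lintegral_indicator_one (hA.inter (measurableSet_lt_apply t n)), ← lintegral_indicator hA]
  refine h.lintegral_indicator_survival_skeleton ht n e _ hA fun z z' hz hzA => ?_
  rwa [mem_preimage, show prefixMap n z' = prefixMap n z from
    funext fun k => (hz k k.2).symm]

/-- The law of the waiting times is unique. -/
lemma eq_of_isWaitingLaw {e : E} {ν ν' : Measure (ℕ → Ioi (0 : ℝ))} [IsProbabilityMeasure ν]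
    [IsProbabilityMeasure ν'] (hν : IsWaitingLaw a lam e ν) (hν' : IsWaitingLaw a lam e ν') :
    ν = ν' := by
  have hpm : ∀ n, Measurable (prefixMap (X := Ioi (0 : ℝ)) n) := measurable_prefixMap
  have key : ∀ n, ν.map (prefixMap n) = ν'.map (prefixMap n) := by
    intro n
    induction n with
    | zero =>
      have h1 := Measure.isProbabilityMeasure_map (μ := ν) (hpm 0).aemeasurable
      have h2 := Measure.isProbabilityMeasure_map (μ := ν') (hpm 0).aemeasurable
      ext s _
      rcases s.eq_empty_or_nonempty with rfl | hs
      · simp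
      · rw [Subsingleton.eq_univ_of_nonempty hs, measure_univ, measure_univ]
    | succ n ih =>
      have hlast : Measurable fun z : ℕ → Ioi (0 : ℝ) => (prefixMap n z, z n) :=
        (hpm n).prodMk (measurable_pi_apply n)
      have hpair : ν.map (fun z => (prefixMap n z, z n)) = ν'.map fun z => (prefixMap n z, z n) := by
        refine Measure.ext_prod fun {B C} hB hC => ?_
        have hint : ∀ {ρ : Measure (ℕ → Ioi (0 : ℝ))}, IsWaitingLaw a lam e ρ →
            ∀ x : ℝ, 0 ≤ x → ((ρ.restrict (prefixMap n ⁻¹' B)).map fun z => z n) {y | x < y}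
              = ∫⁻ p in B, ENNReal.ofReal (survival a lam x (skeleton a e (extendSeq p) n))
                ∂(ρ.map (prefixMap n)) := fun {ρ} hρ x hx => by
          have hmx : MeasurableSet {y : Ioi (0 : ℝ) | x < y} :=
            measurableSet_lt measurable_const measurable_subtype_coe
          have h1 : Measurable fun p : Fin n → Ioi (0 : ℝ) =>
              survival a lam x (skeleton a e (extendSeq p) n) :=
            (h.measurable_survival_skeleton x e n).comp measurable_extendSeq
          rw [Measure.map_apply (measurable_pi_apply n) hmx,
            Measure.restrict_apply ((measurable_pi_apply n) hmx), inter_comm,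
            setLIntegral_map hB h1.ennreal_ofReal (hpm n)]
          simp only [skeleton_extendSeq]
          exact hρ n x hx B hB
        have hC' : (ν.restrict (prefixMap n ⁻¹' B)).map (fun z => z n)
            = (ν'.restrict (prefixMap n ⁻¹' B)).map fun z => z n := by
          have heq : ∀ x : ℝ, 0 ≤ x →
              ((ν.restrict (prefixMap n ⁻¹' B)).map fun z => z n) {y | x < y}
                = ((ν'.restrict (prefixMap n ⁻¹' B)).map fun z => z n) {y | x < y} := fun x hx => by
            rw [hint hν x hx, hint hν' x hx, ih]
          have huniv : {y : Ioi (0 : ℝ) | (0 : ℝ) < y} = univ := eq_univ_of_forall fun y => y.2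
          -- The waiting-law condition gives only tails; `Iic x` is the complement of a tail, and
          -- the total mass is the tail at `0`.
          refine Measure.ext_of_Iic _ _ fun x => ?_
          rw [← compl_Ioi, measure_compl measurableSet_Ioi (measure_ne_top _ _),
            measure_compl measurableSet_Ioi (measure_ne_top _ _), ← huniv, heq 0 le_rfl]
          congr 1
          exact heq x (le_of_lt x.2)
        have happ := congrArg (fun ρ : Measure (Ioi (0 : ℝ)) => ρ C) hC'
        have hmn : Measurable fun z : ℕ → Ioi (0 : ℝ) => z n := measurable_pi_apply n
        simp only [Measure.map_apply hmn hC, Measure.restrict_apply (hmn hC)] at happ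
        rw [Measure.map_apply hlast (hB.prod hC), Measure.map_apply hlast (hB.prod hC)]
        have hpre : (fun z : ℕ → Ioi (0 : ℝ) => (prefixMap n z, z n)) ⁻¹' (B ×ˢ C)
            = (fun z => z n) ⁻¹' C ∩ prefixMap n ⁻¹' B := by
          ext z; simp [and_comm]
        rw [hpre]
        exact happ
      have hsnoc : Measurable fun q : (Fin n → Ioi (0 : ℝ)) × Ioi (0 : ℝ) =>
          (Fin.snoc (α := fun _ => Ioi (0 : ℝ)) q.1 q.2 : Fin (n + 1) → Ioi (0 : ℝ)) := by
        refine measurable_pi_lambda _ fun k => ?_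
        refine Fin.lastCases ?_ (fun k => ?_) k
        · simpa using measurable_snd
        · simpa [Function.comp_def] using (measurable_pi_apply k).comp measurable_fst
      have hcomp : prefixMap (X := Ioi (0 : ℝ)) (n + 1)
          = (fun q : (Fin n → Ioi (0 : ℝ)) × Ioi (0 : ℝ) =>
            (Fin.snoc (α := fun _ => Ioi (0 : ℝ)) q.1 q.2 : Fin (n + 1) → Ioi (0 : ℝ)))
            ∘ fun z => (prefixMap n z, z n) := by
        funext z k
        refine Fin.lastCases ?_ (fun k => ?_) k <;> simp [prefixMap]
      rw [hcomp, ← Measure.map_map hsnoc hlast, ← Measure.map_map hsnoc hlast, hpair]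
  -- Every finite set of indices lies in an initial segment, so equal prefix laws give equal
  -- finite-dimensional marginals, which determine the law.
  have hproj : IsProjectiveLimit ν fun I : Finset ℕ => ν'.map I.restrict := fun I => by
    obtain ⟨n, hn⟩ := I.exists_nat_subset_range
    have hlt : ∀ i : I, (i : ℕ) < n := fun i => Finset.mem_range.mp (hn i.2)
    have hr : Measurable fun (p : Fin n → Ioi (0 : ℝ)) (i : I) => p ⟨i, hlt i⟩ :=
      measurable_pi_lambda _ fun i => measurable_pi_apply _
    have hcomp : I.restrict (π := fun _ : ℕ => Ioi (0 : ℝ))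
        = (fun (p : Fin n → Ioi (0 : ℝ)) (i : I) => p ⟨i, hlt i⟩) ∘ prefixMap n := rfl
    simp only [hcomp, ← Measure.map_map hr (hpm n), key]
  have : ∀ I : Finset ℕ, IsFiniteMeasure (ν'.map I.restrict) := fun I =>
    Measure.isFiniteMeasure_map _ _
  exact hproj.unique fun I => rfl

lemma isWaitingTimes_seqKernel (e : E) :
    IsWaitingTimes a lam e (h.seqKernel e) fun n ω => ω n :=
  (h.isWaitingTimes_iff inferInstance measurable_pi_apply).mpr
    (by simpa using h.isWaitingLaw_seqKernel e)

end IsAdmissible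

lemma IsWaitingTimes.map_eq {Ω : Type*} [MeasurableSpace Ω] {μ : Measure Ω}
    {Z : ℕ → Ω → Ioi (0 : ℝ)} {e : E} (hZ : IsWaitingTimes a lam e μ Z) (h : IsAdmissible a lam) :
    (μ.map fun ω k => Z k ω) = h.seqKernel e := by
  have := hZ.isProbabilityMeasure
  have := Measure.isProbabilityMeasure_map (μ := μ)
    (measurable_pi_lambda (fun ω k => Z k ω) hZ.measurable).aemeasurable
  exact h.eq_of_isWaitingLaw ((h.isWaitingTimes_iff inferInstance hZ.measurable).mp hZ)
    (h.isWaitingLaw_seqKernel e)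

/-! ### The Markov property with respect to the natural filtration -/

section ZigZagProcess

variable {Ω : Type*} [mΩ : MeasurableSpace Ω] {μ : Measure Ω} {Z : ℕ → Ω → Ioi (0 : ℝ)} {e : E}

/-- The σ-algebra of the events that are determined at time `s`. -/
@[reducible] def determinedSpace (Z : ℕ → Ω → Ioi (0 : ℝ)) (s : ℝ≥0) : MeasurableSpace Ω where
  MeasurableSet' A := ∃ A', MeasurableSet A' ∧ IsDetermined s A' ∧ A = (fun ω k => Z k ω) ⁻¹' A'
  measurableSet_empty := ⟨∅, MeasurableSet.empty, fun _ _ _ _ _ _ h => h, rfl⟩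
  measurableSet_compl := by
    rintro _ ⟨A', h1, h2, rfl⟩
    exact ⟨A'ᶜ, h1.compl, h2.compl, rfl⟩
  measurableSet_iUnion := by
    intro f hf
    choose A' h1 h2 h3 using hf
    exact ⟨⋃ k, A' k, MeasurableSet.iUnion h1, IsDetermined.iUnion h2, by
      simp only [preimage_iUnion, h3]⟩

/-- The events up to time `s` are those that are determined at time `s`. -/
lemma exists_isDetermined_of_filtration (hZ : ∀ n, Measurable (Z n)) {s : ℝ≥0} {A : Set Ω}
    (hA : MeasurableSet[filtration a e hZ s] A) :
    ∃ A', MeasurableSet A' ∧ IsDetermined s A' ∧ A = (fun ω k => Z k ω) ⁻¹' A' := by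
  have hle : filtration a e hZ s ≤ determinedSpace Z s := by
    refine iSup₂_le fun r hr => ?_
    rintro _ ⟨B, hB, rfl⟩
    exact ⟨{z | path a e z r ∈ B}, measurable_path a e r hB, isDetermined_path a e hr B, rfl⟩
  exact hle A hA

lemma IsWaitingTimes.map_process (hZ : IsWaitingTimes a lam e μ Z) (h : IsAdmissible a lam)
    (t : ℝ≥0) : μ.map (process a e Z t) = h.semigroup t e := by
  rw [h.semigroup_apply, ← hZ.map_eq h,
    Measure.map_map (measurable_path a e t) (measurable_pi_lambda _ hZ.measurable)]
  rfl

lemma IsWaitingTimes.ae_tendsto_switchTime (hZ : IsWaitingTimes a lam e μ Z)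
    (h : IsAdmissible a lam) :
    ∀ᵐ ω ∂μ, Tendsto (switchTime fun k => Z k ω) atTop atTop := by
  have h1 := h.ae_tendsto_switchTime e
  rw [← hZ.map_eq h] at h1
  exact ae_of_ae_map (measurable_pi_lambda _ hZ.measurable).aemeasurable h1

-- The Markov property on sequence space moves to `Ω` through the joint law of the waiting times.
-- Read for nonnegative functions it is an equality of measures, which can then be integrated
-- against `f`.
open scoped BoundedContinuousFunction in
lemma IsWaitingTimes.setIntegral_process_add (hZ : IsWaitingTimes a lam e μ Z)
    (h : IsAdmissible a lam) (s t : ℝ≥0) {A : Set Ω}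
    (hA : MeasurableSet[filtration a e hZ.measurable s] A) (f : E →ᵇ ℝ) :
    ∫ ω in A, f (process a e Z (s + t) ω) ∂μ
      = ∫ ω in A, ∫ z, f z ∂(h.semigroup t (process a e Z s ω)) ∂μ := by
  have := hZ.isProbabilityMeasure
  obtain ⟨A', hA', hAs, rfl⟩ := exists_isDetermined_of_filtration hZ.measurable hA
  have hZm : Measurable fun ω k => Z k ω := measurable_pi_lambda _ hZ.measurable
  have hm := fun r => measurable_process a e hZ.measurable r
  set D := (fun ω k => Z k ω) ⁻¹' A'
  have hmap : (μ.restrict D).map (process a e Z (s + t))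
      = h.semigroup t ∘ₘ ((μ.restrict D).map (process a e Z s)) := by
    refine Measure.ext_of_lintegral _ fun g hg => ?_
    rw [lintegral_map hg (hm _), Measure.lintegral_bind (Kernel.aemeasurable _) hg.aemeasurable,
      lintegral_map hg.lintegral_kernel (hm _)]
    have h1 := h.setLIntegral_path_add s t e hA' hAs hg
    rw [← hZ.map_eq h, setLIntegral_map hA' (measurable_comp_path a _ e hg) hZm,
      setLIntegral_map hA' (measurable_comp_path a _ e hg.lintegral_kernel) hZm] at h1
    exact h1
  rw [← integral_map (f := f) (hm _).aemeasurable f.continuous.measurable.aestronglyMeasurable, hmap,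
    integral_measure_comp (f.integrable _), integral_map (hm _).aemeasurable]
  exact (StronglyMeasurable.integral_kernel_prod_right' (f := fun p : E × E => f p.2)
    (f.continuous.measurable.comp measurable_snd).stronglyMeasurable).aestronglyMeasurable

end ZigZagProcess

end ZigZag
namespace ZigZag

/-! ### The Feller property -/

variable {a : ℝ} {lam : E → ℝ}

namespace IsAdmissible

variable (h : IsAdmissible a lam)
include h

lemma continuous_waitDensity_mul {u : ℝ≥0 × E → ℝ} (hu : Continuous u) :
    Continuous fun q : (ℝ≥0 × E) × ℝ => waitDensity a lam q.1.2 q.2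
      * u (Real.toNNReal (q.1.1 - q.2), jump a q.2 q.1.2) := by
  refine (h.continuous_waitDensity.comp
    (by fun_prop : Continuous fun q : (ℝ≥0 × E) × ℝ => (q.1.2, q.2))).mul (hu.comp ?_)
  exact (continuous_real_toNNReal.comp (by fun_prop)).prodMk
    ((continuous_jump a).comp (by fun_prop : Continuous fun q : (ℝ≥0 × E) × ℝ => (q.2, q.1.2)))

lemma integral_waitKernel (e : E) (H : ℝ → ℝ) :
    ∫ x, H x ∂(waitKernel a lam e) = ∫ s in Ioi (0 : ℝ), waitDensity a lam e s * H s := by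
  have hm : Measurable fun z : Ioi (0 : ℝ) => ENNReal.ofReal (waitDensity a lam e z) :=
    h.measurable_waitDensity.comp measurable_prodMk_left
  rw [waitKernel, Kernel.withDensity_apply _ h.measurable_waitDensity, Kernel.const_apply,
    integral_withDensity_eq_integral_toReal_smul hm (.of_forall fun _ => ENNReal.ofReal_lt_top)]
  simp only [ENNReal.toReal_ofReal (h.waitDensity_nonneg _ _),
    smul_eq_mul]
  exact integral_subtype_comap measurableSet_Ioi fun s => waitDensity a lam e s * H s

lemma integrableOn_waitDensity (e : E) : IntegrableOn (waitDensity a lam e) (Ioi 0) := by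
  have hc : Continuous (waitDensity a lam e) :=
    h.continuous_waitDensity.comp (by fun_prop : Continuous fun s : ℝ => (e, s))
  refine ⟨hc.aestronglyMeasurable, ?_⟩
  rw [hasFiniteIntegral_iff_ofReal (.of_forall fun s => h.waitDensity_nonneg e s),
    h.lintegral_waitDensity_Ioi e]
  exact ENNReal.ofReal_lt_top

lemma integral_waitDensity_Ioi {t : ℝ} (ht : 0 ≤ t) (e : E) :
    ∫ s in Ioi t, waitDensity a lam e s = survival a lam t e := by
  have hint := (h.integrableOn_waitDensity e).mono_set (Ioi_subset_Ioi ht)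
  rw [integral_eq_lintegral_of_nonneg_ae (.of_forall fun s => h.waitDensity_nonneg e s)
    hint.aestronglyMeasurable, h.lintegral_waitDensity_Ioi,
    ENNReal.toReal_ofReal (survival_pos _ _).le]

/-- First-step decomposition according to whether the first switch occurs before time `t`. -/
lemma integral_seqKernel_split (e : E) {H : (ℕ → Ioi (0 : ℝ)) → ℝ} (hH : Measurable H)
    {C : ℝ} (hC : ∀ z, |H z| ≤ C) {t : ℝ} (ht : 0 ≤ t) {c : ℝ} {v : ℝ → ℝ}
    (hv : IntervalIntegrable (fun s => waitDensity a lam e s * v s) volume 0 t)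
    (hgt : ∀ x : Ioi (0 : ℝ), t < x → ∫ z, H (seqCons x z) ∂(h.seqKernel (jump a x e)) = c)
    (hle : ∀ x : Ioi (0 : ℝ), (x : ℝ) ≤ t →
      ∫ z, H (seqCons x z) ∂(h.seqKernel (jump a x e)) = v x) :
    ∫ z, H z ∂(h.seqKernel e)
      = survival a lam t e * c + ∫ s in (0 : ℝ)..t, waitDensity a lam e s * v s := by
  classical
  let g : ℝ → ℝ := fun s => if t < s then c else v s
  have h1 : ∀ x : Ioi (0 : ℝ), ∫ z, H (seqCons x z) ∂(h.seqKernel (jump a x e)) = g x := fun x => by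
    by_cases hx : t < (x : ℝ)
    · simp only [g, if_pos hx, hgt x hx]
    · simp only [g, if_neg hx, hle x (not_lt.mp hx)]
  rw [h.integral_seqKernel e hH hC]
  simp only [h1]
  rw [h.integral_waitKernel, ← Ioc_union_Ioi_eq_Ioi ht,
    setIntegral_union (Ioc_disjoint_Ioi le_rfl) measurableSet_Ioi, add_comm,
    setIntegral_congr_fun (g := fun s => waitDensity a lam e s * c) measurableSet_Ioi
      (fun s hs => by simp only [g, if_pos (mem_Ioi.mp hs)]), integral_mul_const,
    h.integral_waitDensity_Ioi ht, intervalIntegral.integral_of_le ht]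
  · congr 1
    exact setIntegral_congr_fun measurableSet_Ioc
      fun s hs => by simp only [g, if_neg (not_lt.mpr hs.2)]
  · exact hv.1.congr_fun (fun s hs => by simp only [g, if_neg (not_lt.mpr hs.2)]) measurableSet_Ioc
  · exact IntegrableOn.congr_fun
      (((h.integrableOn_waitDensity e).mono_set (Ioi_subset_Ioi ht)).mul_const c)
      (fun s hs => by simp only [g, if_pos (mem_Ioi.mp hs)]) measurableSet_Ioi

end IsAdmissible

section Feller

variable (h : IsAdmissible a lam) {f : E → ℝ}

/-- The expectation of `f` at time `t` on the event that there are less than `n` switches up to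
time `t`. -/
noncomputable def IsAdmissible.truncatedMean (f : E → ℝ) (n : ℕ) (p : ℝ≥0 × E) : ℝ :=
  ∫ z, {z : ℕ → Ioi (0 : ℝ) | (p.1 : ℝ) < switchTime z n}.indicator
    (fun z => f (path a p.2 z p.1)) z ∂(h.seqKernel p.2)

lemma measurableSet_lt_switchTime (t : ℝ) (n : ℕ) :
    MeasurableSet {z : ℕ → Ioi (0 : ℝ) | t < switchTime z n} :=
  measurableSet_lt measurable_const (measurable_switchTime n)

namespace IsAdmissible

lemma integral_semigroup (hf : Continuous f) (t : ℝ≥0) (e : E) :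
    ∫ y, f y ∂(h.semigroup t e) = ∫ z, f (path a e z t) ∂(h.seqKernel e) := by
  rw [semigroup_apply, integral_map (measurable_path a e t).aemeasurable
    hf.measurable.aestronglyMeasurable]

lemma abs_integral_semigroup_le {C : ℝ} (hC : ∀ x, |f x| ≤ C) (t : ℝ≥0) (e : E) :
    |∫ y, f y ∂(h.semigroup t e)| ≤ C := by
  have := norm_integral_le_of_norm_le_const (μ := h.semigroup t e) (f := f) (C := C) (.of_forall fun z => hC z)
  simpa using this

/-- Either the first switch is later than `p.1`, or it happens at some `s` and fewer than `n`
switches follow. Every term is continuous once the `n`-th truncation is, so continuity propagates.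
-/
lemma truncatedMean_succ (hf : Continuous f) {C : ℝ} (hC : ∀ x, |f x| ≤ C) {n : ℕ}
    (hn : Continuous (h.truncatedMean f n)) (p : ℝ≥0 × E) :
    h.truncatedMean f (n + 1) p = survival a lam p.1 p.2 * f (flow a p.1 p.2)
      + ∫ s in (0 : ℝ)..p.1, waitDensity a lam p.2 s
        * h.truncatedMean f n (Real.toNNReal (p.1 - s), jump a s p.2) := by
  obtain ⟨t, e⟩ := p
  have hC0 : 0 ≤ C := (abs_nonneg _).trans (hC e)
  refine h.integral_seqKernel_split (C := C) e
    ((measurable_comp_path a t e hf.measurable).indicator (measurableSet_lt_switchTime t (n + 1)))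
    (fun z => ?_) t.coe_nonneg
    (v := fun s => h.truncatedMean f n (Real.toNNReal (t - s), jump a s e)) ?_
    (fun x hx => ?_) fun x hx => ?_
  · by_cases hz : z ∈ {z : ℕ → Ioi (0 : ℝ) | (t : ℝ) < switchTime z (n + 1)}
    · rw [indicator_of_mem hz]; exact hC _
    · rw [indicator_of_notMem hz, abs_zero]; exact hC0
  · exact ((h.continuous_waitDensity_mul hn).comp
      (by fun_prop : Continuous fun s : ℝ => ((t, e), s))).intervalIntegrable _ _
  · have h1 : ∀ z, {z : ℕ → Ioi (0 : ℝ) | (t : ℝ) < switchTime z (n + 1)}.indicator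
        (fun z => f (path a e z t)) (seqCons x z) = f (flow a t e) := fun z => by
      rw [indicator_of_mem, path_eq_flow (by simpa using hx)]
      rw [mem_ofPred_eq, switchTime_seqCons]
      exact hx.trans_le (le_add_of_nonneg_right switchTime_nonneg)
    simp only [h1, integral_const, probReal_univ, one_smul]
  · have hr : ((Real.toNNReal (t - x) : ℝ≥0) : ℝ) = t - x :=
      Real.coe_toNNReal _ (sub_nonneg.mpr hx)
    refine integral_congr_ae (.of_forall fun z => ?_)
    have hiff : seqCons x z ∈ {z : ℕ → Ioi (0 : ℝ) | (t : ℝ) < switchTime z (n + 1)}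
        ↔ z ∈ {z : ℕ → Ioi (0 : ℝ) | ((Real.toNNReal (t - x) : ℝ≥0) : ℝ) < switchTime z n} := by
      rw [mem_ofPred_eq, mem_ofPred_eq, switchTime_seqCons, hr, sub_lt_iff_lt_add']
    by_cases hz : z ∈ {z : ℕ → Ioi (0 : ℝ) | ((Real.toNNReal (t - x) : ℝ≥0) : ℝ) < switchTime z n}
    · simp only [indicator_of_mem hz, indicator_of_mem (hiff.mpr hz)]
      rw [path_seqCons hr hz]
    · simp only [indicator_of_notMem hz, indicator_of_notMem (mt hiff.mp hz)]

lemma continuous_truncatedMean (hf : Continuous f) {C : ℝ} (hC : ∀ x, |f x| ≤ C) (n : ℕ) :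
    Continuous (h.truncatedMean f n) := by
  induction n with
  | zero =>
    have : h.truncatedMean f 0 = fun _ => 0 := by
      funext p
      simp only [truncatedMean, switchTime_zero, not_lt.mpr p.1.coe_nonneg, ofPred_false,
        indicator_empty, integral_zero]
    rw [this]; exact continuous_const
  | succ n ih =>
    have heq : h.truncatedMean f (n + 1) = fun p : ℝ≥0 × E =>
      survival a lam p.1 p.2 * f (flow a p.1 p.2)
      + ∫ s in (0 : ℝ)..p.1, waitDensity a lam p.2 s
        * h.truncatedMean f n (Real.toNNReal (p.1 - s), jump a s p.2) :=
      funext fun p => h.truncatedMean_succ hf hC ih p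
    rw [heq]
    have hp : Continuous fun p : ℝ≥0 × E => ((p.1 : ℝ), p.2) := by fun_prop
    refine ((h.continuous_survival.comp hp).mul (hf.comp ((continuous_flow a).comp hp))).add ?_
    exact intervalIntegral.continuous_parametric_intervalIntegral_of_continuous
      (f := fun (p : ℝ≥0 × E) s => waitDensity a lam p.2 s
        * h.truncatedMean f n (Real.toNNReal (p.1 - s), jump a s p.2))
      (h.continuous_waitDensity_mul ih) (by fun_prop)

lemma abs_integral_semigroup_sub_truncatedMean_le (hf : Continuous f) {C : ℝ}
    (hC : ∀ x, |f x| ≤ C) (n : ℕ) (p : ℝ≥0 × E) :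
    |(∫ y, f y ∂(h.semigroup p.1 p.2)) - h.truncatedMean f n p|
      ≤ C * (h.seqKernel p.2).real {z | switchTime z n ≤ p.1} := by
  obtain ⟨t, e⟩ := p
  have hm := measurable_comp_path a t e hf.measurable
  have hint : Integrable (fun z => f (path a e z t)) (h.seqKernel e) :=
    Integrable.of_bound hm.aestronglyMeasurable C (.of_forall fun z => hC _)
  have hset : MeasurableSet {z : ℕ → Ioi (0 : ℝ) | switchTime z n ≤ t} :=
    measurableSet_le (measurable_switchTime n) measurable_const
  rw [h.integral_semigroup hf, truncatedMean,
    ← integral_sub hint (hint.indicator (measurableSet_lt_switchTime t n))]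
  have heq : ∀ z, f (path a e z t) - {z : ℕ → Ioi (0 : ℝ) | (t : ℝ) < switchTime z n}.indicator
      (fun z => f (path a e z t)) z
      = {z : ℕ → Ioi (0 : ℝ) | switchTime z n ≤ t}.indicator (fun z => f (path a e z t)) z := by
    intro z
    by_cases hz : switchTime z n ≤ t
    · simp [indicator, hz, not_lt.mpr hz]
    · simp [indicator, hz, not_le.mp hz]
  simp only [heq]
  rw [integral_indicator hset]
  exact norm_setIntegral_le_of_norm_le_const (f := fun z => f (path a e z t)) (C := C)
    (measure_lt_top _ _) fun z _ => hC _

/-- The semigroup is Feller, jointly in time and space. -/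
theorem continuous_integral_semigroup (hf : Continuous f) {C : ℝ} (hC : ∀ x, |f x| ≤ C) :
    Continuous fun p : ℝ≥0 × E => ∫ y, f y ∂(h.semigroup p.1 p.2) := by
  refine continuous_of_locally_uniform_approx_of_continuousAt fun p₀ V hV => ?_
  obtain ⟨ε, hε, hεV⟩ := Metric.mem_uniformity_dist.mp hV
  -- The constants `T` and `R` serve a whole neighbourhood of `p₀`, so one `M`, and then one `n`,
  -- bounds the truncation error uniformly there.
  set T : ℝ := p₀.1 + 1
  set R : ℝ := |p₀.2.1| + 1 + a * T
  have hC0 : 0 ≤ C := (abs_nonneg _).trans (hC p₀.2)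
  obtain ⟨M, hM0, hM⟩ := h.exists_rate_le R
  have hlim : Tendsto (fun n : ℕ => C * ((M * T) ^ n / n.factorial)) atTop (𝓝 0) := by
    simpa using (FloorSemiring.tendsto_pow_div_factorial_atTop (M * T)).const_mul C
  obtain ⟨n, hn⟩ := (hlim.eventually (gt_mem_nhds hε)).exists
  have h1 : ∀ᶠ p : ℝ≥0 × E in 𝓝 p₀, (p.1 : ℝ) < T :=
    ((by fun_prop : Continuous fun p : ℝ≥0 × E => (p.1 : ℝ)).tendsto p₀).eventually
      (gt_mem_nhds (by simp [T]))
  have h2 : ∀ᶠ p : ℝ≥0 × E in 𝓝 p₀, |p.2.1| < |p₀.2.1| + 1 :=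
    ((by fun_prop : Continuous fun p : ℝ≥0 × E => |p.2.1|).tendsto p₀).eventually
      (gt_mem_nhds (by simp))
  refine ⟨_, h1.and h2, h.truncatedMean f n, (h.continuous_truncatedMean hf hC n).continuousAt,
    fun p hp => hεV ?_⟩
  have hpT : (p.1 : ℝ) ≤ T := hp.1.le
  have hp1 : |p.2.1| + a * p.1 ≤ R :=
    add_le_add hp.2.le (mul_le_mul_of_nonneg_left hpT h.speed_pos.le)
  have hpos : 0 ≤ (M * (p.1 : ℝ)) ^ n / n.factorial := by positivity
  rw [Real.dist_eq]
  refine (h.abs_integral_semigroup_sub_truncatedMean_le hf hC n p).trans_lt (lt_of_le_of_lt ?_ hn)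
  refine mul_le_mul_of_nonneg_left ?_ hC0
  refine (ENNReal.toReal_mono ENNReal.ofReal_ne_top
    (h.seqKernel_switchTime_le hM0 hM n p.1 p.2 p.1.coe_nonneg hp1)).trans ?_
  rw [ENNReal.toReal_ofReal hpos]
  gcongr

/-- The renewal equation. -/
lemma integral_semigroup_eq (hf : Continuous f) {C : ℝ} (hC : ∀ x, |f x| ≤ C) (t : ℝ≥0) (e : E) :
    ∫ y, f y ∂(h.semigroup t e) = survival a lam t e * f (flow a t e)
      + ∫ s in (0 : ℝ)..t, waitDensity a lam e s
        * ∫ y, f y ∂(h.semigroup (Real.toNNReal (t - s)) (jump a s e)) := by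
  rw [h.integral_semigroup hf]
  refine h.integral_seqKernel_split (C := C) e (measurable_comp_path a t e hf.measurable)
    (fun z => hC _) t.coe_nonneg
    (v := fun s => ∫ y, f y ∂(h.semigroup (Real.toNNReal (t - s)) (jump a s e))) ?_
    (fun x hx => ?_) fun x hx => ?_
  · exact ((h.continuous_waitDensity_mul (h.continuous_integral_semigroup hf hC)).comp
      (by fun_prop : Continuous fun s : ℝ => ((t, e), s))).intervalIntegrable _ _
  · have h1 : ∀ z, f (path a e (seqCons x z) t) = f (flow a t e) := fun z => by
      rw [path_eq_flow (by simpa using hx)]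
    simp only [h1, integral_const, probReal_univ, one_smul]
  · have hr : ((Real.toNNReal (t - x) : ℝ≥0) : ℝ) = t - x :=
      Real.coe_toNNReal _ (sub_nonneg.mpr hx)
    rw [h.integral_semigroup hf]
    refine integral_congr_ae ?_
    filter_upwards [h.ae_exists_lt_switchTime (jump a x e) (Real.toNNReal (t - x) : ℝ≥0)]
      with z ⟨m, hm⟩
    rw [path_seqCons hr hm]

end IsAdmissible

end Feller

lemma IsWaitingTimes.isStrongMarkov {Ω : Type*} [mΩ : MeasurableSpace Ω] {μ : Measure Ω}
    {Z : ℕ → Ω → Ioi (0 : ℝ)} {e : E} (hZ : IsWaitingTimes a lam e μ Z) (h : IsAdmissible a lam) :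
    IsStrongMarkov μ (filtration a e hZ.measurable) (process a e Z) h.semigroup := by
  have := hZ.isProbabilityMeasure
  refine isStrongMarkov_of_feller (fun t => inferInstance) (fun t f => ?_) (fun t => ?_)
    (fun ω t => path_rightContinuous a e _ t)
    fun s t A hA f => hZ.setIntegral_process_add h s t hA f
  · exact (h.continuous_integral_semigroup f.continuous (fun x => f.norm_coe_le_norm x)).comp
      (by fun_prop : Continuous fun e : E => (t, e))
  · exact (Filtration.stronglyAdapted_natural
      fun t => (measurable_process a e hZ.measurable t).stronglyMeasurable) t |>.measurable

end ZigZag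
namespace ZigZag

/-! ### The semigroup on `C₀(E)` -/

variable {a : ℝ} {lam : E → ℝ}

/-- The factor `ℤˣ` is compact, so only the position can escape to infinity. -/
lemma cocompact_eq_comap : cocompact E = comap (fun e : E => |e.1|) atTop := by
  have h : comap (fun y : ℝ => |y|) atTop = cocompact ℝ := by
    rw [← Metric.cobounded_eq_cocompact, ← comap_norm_atTop]; rfl
  rw [← coprod_cocompact, Filter.coprod, cocompact_eq_bot (X := ℤˣ), comap_bot, sup_bot_eq, ← h,
    comap_comap]
  rfl

instance : (cocompact E).IsCountablyGenerated := by
  rw [cocompact_eq_comap]; infer_instance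

lemma exists_forall_abs_le_of_tendsto {f : E → ℝ} (hf : Tendsto f (cocompact E) (𝓝 0)) {ε : ℝ}
    (hε : 0 < ε) : ∃ R, ∀ e : E, R ≤ |e.1| → |f e| ≤ ε := by
  have h1 : ∀ᶠ e in cocompact E, |f e| ≤ ε := by
    filter_upwards [(Metric.tendsto_nhds.mp hf) ε hε] with e he
    rw [Real.dist_eq, sub_zero] at he
    exact he.le
  rw [cocompact_eq_comap, eventually_comap] at h1
  obtain ⟨R, hR⟩ := eventually_atTop.mp h1
  exact ⟨R, fun e he => hR _ he e rfl⟩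

lemma tendsto_of_forall_exists_abs_le {f : E → ℝ}
    (hf : ∀ ε > 0, ∃ R, ∀ e : E, R ≤ |e.1| → |f e| ≤ ε) : Tendsto f (cocompact E) (𝓝 0) := by
  refine Metric.tendsto_nhds.mpr fun ε hε => ?_
  obtain ⟨R, hR⟩ := hf (ε / 2) (half_pos hε)
  rw [cocompact_eq_comap, eventually_comap]
  filter_upwards [eventually_ge_atTop R] with r hr e he
  rw [Real.dist_eq, sub_zero]
  exact (hR e (he ▸ hr)).trans_lt (half_lt_self hε)

lemma abs_zeroAtInfty_le (f : C₀(E, ℝ)) (e : E) : |f e| ≤ ‖f‖ := by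
  rw [← ZeroAtInftyContinuousMap.norm_toBCF_eq_norm]
  exact f.toBCF.norm_coe_le_norm e

namespace IsAdmissible

variable (h : IsAdmissible a lam)

/-- The function `P_t f`. -/
noncomputable def mean (f : C₀(E, ℝ)) (t : ℝ≥0) (e : E) : ℝ := ∫ y, f y ∂(h.semigroup t e)

lemma continuous_mean (f : C₀(E, ℝ)) : Continuous fun p : ℝ≥0 × E => h.mean f p.1 p.2 :=
  h.continuous_integral_semigroup f.continuous (abs_zeroAtInfty_le f)

lemma abs_mean_le (f : C₀(E, ℝ)) (t : ℝ≥0) (e : E) : |h.mean f t e| ≤ ‖f‖ :=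
  h.abs_integral_semigroup_le (abs_zeroAtInfty_le f) t e

lemma mean_zero (f : C₀(E, ℝ)) (e : E) : h.mean f 0 e = f e := by
  rw [mean, h.isMarkovSemigroup.zero, Kernel.id_apply, integral_dirac]

lemma mean_sub (f g : C₀(E, ℝ)) (t : ℝ≥0) (e : E) :
    h.mean (f - g) t e = h.mean f t e - h.mean g t e := by
  have hi : ∀ f : C₀(E, ℝ), Integrable f (h.semigroup t e) := fun f =>
    Integrable.of_bound f.continuous.measurable.aestronglyMeasurable ‖f‖
      (.of_forall (abs_zeroAtInfty_le f))
  exact integral_sub (hi f) (hi g)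

lemma mean_add (f : C₀(E, ℝ)) (s t : ℝ≥0) (e : E) :
    h.mean f (s + t) e = ∫ y, h.mean f t y ∂(h.semigroup s e) := by
  rw [mean, h.isMarkovSemigroup.add, Kernel.integral_comp]
  · rfl
  · exact Integrable.of_bound f.continuous.measurable.aestronglyMeasurable ‖f‖
      (.of_forall (abs_zeroAtInfty_le f))

/-- Finite speed: a path started at distance at least `R + a t` is still at distance at least `R` at
time `t`. -/
lemma exists_forall_abs_mean_le (f : C₀(E, ℝ)) {ε : ℝ} (hε : 0 < ε) :
    ∃ R, ∀ (t : ℝ≥0) (e : E), R + a * t ≤ |e.1| → |h.mean f t e| ≤ ε := by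
  obtain ⟨R, hR⟩ := exists_forall_abs_le_of_tendsto f.zero_at_infty' hε
  refine ⟨R, fun t e he => ?_⟩
  rw [mean, h.integral_semigroup (map_continuous f)]
  have hle : ∀ z, ‖f (path a e z t)‖ ≤ ε := fun z => by
    refine hR _ ?_
    have h1 := abs_path_sub_le (e := e) (z := z) h.speed_pos.le t
    have h2 := abs_sub_abs_le_abs_sub e.1 (path a e z t).1
    rw [abs_sub_comm] at h2
    linarith
  have := norm_integral_le_of_norm_le_const (μ := h.seqKernel e) (.of_forall hle)
  simpa using this

lemma tendsto_mean_cocompact (f : C₀(E, ℝ)) (t : ℝ≥0) :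
    Tendsto (h.mean f t) (cocompact E) (𝓝 0) := by
  refine tendsto_of_forall_exists_abs_le fun ε hε => ?_
  obtain ⟨R, hR⟩ := h.exists_forall_abs_mean_le f hε
  exact ⟨R + a * t, fun e he => hR t e he⟩

/-- Strong continuity of the semigroup. -/
lemma eventually_abs_mean_sub_le (f : C₀(E, ℝ)) {ε : ℝ} (hε : 0 < ε) :
    ∀ᶠ t : ℝ≥0 in 𝓝 0, ∀ e, |h.mean f t e - f e| ≤ ε := by
  obtain ⟨R, hR⟩ := h.exists_forall_abs_mean_le f (half_pos hε)
  -- On this compact set joint continuity is uniform; outside it, for `t < 1`, both `P_t f` and `f`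
  -- are at most `ε / 2`.
  have hK : IsCompact (Icc (-(R + a)) (R + a) ×ˢ (univ : Set ℤˣ)) :=
    isCompact_Icc.prod isCompact_univ
  obtain ⟨v, hv, hvK⟩ := hK.mem_uniformity_of_prod (f := h.mean f) (s := univ) (q := 0)
    (h.continuous_mean f).continuousOn (mem_univ _) (Metric.dist_mem_uniformity hε)
  rw [nhdsWithin_univ] at hv
  have h1 : ∀ᶠ t : ℝ≥0 in 𝓝 0, t < 1 := gt_mem_nhds one_pos
  filter_upwards [hv, h1] with t htv ht1 e
  by_cases he : |e.1| ≤ R + a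
  · have := hvK t htv e ⟨abs_le.mp he, mem_univ _⟩
    rw [mean_zero] at this
    exact (le_of_lt this)
  · have hat : a * t ≤ a := mul_le_of_le_one_right h.speed_pos.le (by exact_mod_cast ht1.le)
    have h2 := hR t e (by linarith)
    have h3 := hR 0 e (by simp only [NNReal.coe_zero, mul_zero]; linarith [h.speed_pos])
    rw [mean_zero] at h3
    exact (abs_sub _ _).trans (by linarith)

/-! ### The resolvent -/

/-- The resolvent `∫₀^∞ e⁻ᵗ P_t f dt`. -/
noncomputable def resolventFun (f : C₀(E, ℝ)) (e : E) : ℝ :=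
  ∫ t in Ioi (0 : ℝ), Real.exp (-t) * h.mean f t.toNNReal e

lemma abs_exp_mul_mean_le (f : C₀(E, ℝ)) (t : ℝ) (e : E) :
    ‖Real.exp (-t) * h.mean f t.toNNReal e‖ ≤ Real.exp (-t) * ‖f‖ := by
  rw [norm_mul, Real.norm_of_nonneg (Real.exp_pos _).le]
  exact mul_le_mul_of_nonneg_left (h.abs_mean_le f _ e) (Real.exp_pos _).le

lemma continuous_exp_mul_mean (f : C₀(E, ℝ)) :
    Continuous fun p : ℝ × E => Real.exp (-p.1) * h.mean f p.1.toNNReal p.2 := by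
  have h1 : Continuous fun p : ℝ × E => (p.1.toNNReal, p.2) :=
    (continuous_real_toNNReal.comp continuous_fst).prodMk continuous_snd
  have h2 := (h.continuous_mean f).comp h1
  simp only [Function.comp_def] at h2
  exact (by fun_prop : Continuous fun p : ℝ × E => Real.exp (-p.1)).mul h2

lemma continuous_exp_mul_mean_left (f : C₀(E, ℝ)) (e : E) :
    Continuous fun t : ℝ => Real.exp (-t) * h.mean f t.toNNReal e :=
  (h.continuous_exp_mul_mean f).comp (by fun_prop : Continuous fun t : ℝ => (t, e))

lemma integrableOn_exp_mul_mean (f : C₀(E, ℝ)) (e : E) (c : ℝ) :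
    IntegrableOn (fun t : ℝ => Real.exp (-t) * h.mean f t.toNNReal e) (Ioi c) :=
  Integrable.mono' ((integrableOn_exp_neg_Ioi c).mul_const ‖f‖)
    (h.continuous_exp_mul_mean_left f e).aestronglyMeasurable
    (.of_forall fun t => h.abs_exp_mul_mean_le f t e)

lemma abs_resolventFun_le (f : C₀(E, ℝ)) (e : E) : |h.resolventFun f e| ≤ ‖f‖ := by
  have h1 := norm_integral_le_of_norm_le ((integrableOn_exp_neg_Ioi 0).mul_const ‖f‖)
    (.of_forall fun t => h.abs_exp_mul_mean_le f t e)
  rw [integral_mul_const, integral_exp_neg_Ioi_zero, one_mul] at h1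
  exact h1

lemma continuous_resolventFun (f : C₀(E, ℝ)) : Continuous (h.resolventFun f) :=
  continuous_of_dominated (fun e => (h.continuous_exp_mul_mean_left f e).aestronglyMeasurable)
    (fun e => .of_forall fun t => h.abs_exp_mul_mean_le f t e)
    ((integrableOn_exp_neg_Ioi 0).mul_const ‖f‖)
    (.of_forall fun t => (h.continuous_exp_mul_mean f).comp
      (by fun_prop : Continuous fun e : E => (t, e)))

lemma tendsto_resolventFun (f : C₀(E, ℝ)) : Tendsto (h.resolventFun f) (cocompact E) (𝓝 0) := by
  have h1 := tendsto_integral_filter_of_dominated_convergence (l := cocompact E)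
    (μ := volume.restrict (Ioi (0 : ℝ)))
    (F := fun e t => Real.exp (-t) * h.mean f t.toNNReal e) (f := fun _ => 0)
    (fun t => Real.exp (-t) * ‖f‖)
    (.of_forall fun e => (h.continuous_exp_mul_mean_left f e).aestronglyMeasurable)
    (.of_forall fun e => .of_forall fun t => h.abs_exp_mul_mean_le f t e)
    ((integrableOn_exp_neg_Ioi 0).mul_const ‖f‖)
    (.of_forall fun t => by
      simpa using (h.tendsto_mean_cocompact f t.toNNReal).const_mul (Real.exp (-t)))
  rw [integral_zero] at h1
  exact h1

/-- The resolvent as a map from `C₀(E)` to itself. -/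
noncomputable def resolvent (f : C₀(E, ℝ)) : C₀(E, ℝ) where
  toFun := h.resolventFun f
  continuous_toFun := h.continuous_resolventFun f
  zero_at_infty' := h.tendsto_resolventFun f

lemma resolvent_apply (f : C₀(E, ℝ)) (e : E) :
    h.resolvent f e = ∫ t in Ioi (0 : ℝ), Real.exp (-t) * h.mean f t.toNNReal e := rfl

lemma resolvent_sub (f g : C₀(E, ℝ)) : h.resolvent (f - g) = h.resolvent f - h.resolvent g := by
  ext e
  rw [ZeroAtInftyContinuousMap.sub_apply, resolvent_apply, resolvent_apply, resolvent_apply,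
    ← integral_sub (h.integrableOn_exp_mul_mean f e 0) (h.integrableOn_exp_mul_mean g e 0)]
  simp only [mean_sub, mul_sub]

lemma continuous_resolvent : Continuous h.resolvent := by
  refine (LipschitzWith.of_dist_le_mul (K := 1) fun f g => ?_).continuous
  rw [NNReal.coe_one, one_mul, dist_eq_norm, dist_eq_norm, ← resolvent_sub,
    ← ZeroAtInftyContinuousMap.norm_toBCF_eq_norm]
  exact (BoundedContinuousFunction.norm_le (norm_nonneg _)).mpr fun e =>
    h.abs_resolventFun_le (f - g) e

/-! ### The resolvent takes values in the domain of `L` -/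

/-- The renewal equation for the resolvent. -/
lemma resolvent_eq (f : C₀(E, ℝ)) (e : E) :
    IntegrableOn (fun t : ℝ => Real.exp (-t) * survival a lam t e
      * (f (flow a t e) + lam (flow a t e) * h.resolvent f (jump a t e))) (Ioi 0) ∧
    h.resolvent f e = ∫ t in Ioi (0 : ℝ), Real.exp (-t) * survival a lam t e
      * (f (flow a t e) + lam (flow a t e) * h.resolvent f (jump a t e)) := by
  have hec : Continuous fun t : ℝ => (t, e) := by fun_prop
  have hsurv : Continuous fun t : ℝ => survival a lam t e := h.continuous_survival.comp hec
  have hflow : Continuous fun t : ℝ => flow a t e := (continuous_flow a).comp hec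
  have hjump : Continuous fun t : ℝ => jump a t e := (continuous_jump a).comp hec
  have hdens : Continuous (waitDensity a lam e) :=
    h.continuous_waitDensity.comp (by fun_prop : Continuous fun s : ℝ => (e, s))
  -- The cutoff encodes the triangle `s ≤ t`, so that Fubini can be applied on a product.
  -- Integrating over `s` first gives the renewal term; integrating over `t` first gives the
  -- resolvent after the jump.
  let b : ℝ → ℝ → ℝ := fun t s =>
    if s ≤ t then h.mean f (t - s).toNNReal (jump a s e) else 0
  have hbm : Measurable fun p : ℝ × ℝ => b p.1 p.2 := by
    refine Measurable.ite (measurableSet_le measurable_snd measurable_fst) ?_ measurable_const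
    refine ((h.continuous_mean f).comp ((continuous_real_toNNReal.comp ?_).prodMk
      (hjump.comp continuous_snd))).measurable
    fun_prop
  have hbb : ∀ t s, ‖b t s‖ ≤ ‖f‖ := fun t s => by
    simp only [b]
    split_ifs
    · exact h.abs_mean_le f _ _
    · simp
  have hint : Integrable (Function.uncurry fun t s =>
      b t s * (Real.exp (-t) * waitDensity a lam e s))
      ((volume.restrict (Ioi (0 : ℝ))).prod (volume.restrict (Ioi (0 : ℝ)))) :=
    ((integrableOn_exp_neg_Ioi 0).mul_prod (h.integrableOn_waitDensity e)).bdd_mul (c := ‖f‖)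
      hbm.aestronglyMeasurable (.of_forall fun p => hbb p.1 p.2)
  have hswap := integral_integral_swap hint
  have hleft : ∀ t ∈ Ioi (0 : ℝ),
      ∫ s in Ioi (0 : ℝ), b t s * (Real.exp (-t) * waitDensity a lam e s)
      = Real.exp (-t) * (h.mean f t.toNNReal e - survival a lam t e * f (flow a t e)) := by
    intro t ht
    have ht0 : (0 : ℝ) ≤ t := le_of_lt ht
    have hu := h.integral_semigroup_eq (map_continuous f) (abs_zeroAtInfty_le f) t.toNNReal e
    simp only [Real.coe_toNNReal t ht0] at hu
    rw [mean, hu, add_sub_cancel_left, ← intervalIntegral.integral_const_mul,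
      intervalIntegral.integral_of_le ht0, ← Ioc_union_Ioi_eq_Ioi ht0,
      setIntegral_union (Ioc_disjoint_Ioi le_rfl) measurableSet_Ioi,
      setIntegral_eq_zero_of_forall_eq_zero (t := Ioi t), add_zero]
    · refine setIntegral_congr_fun measurableSet_Ioc fun s hs => ?_
      simp only [b, if_pos hs.2, mean]
      ring
    · intro s hs
      simp only [b, if_neg (not_le.mpr (mem_Ioi.mp hs)), zero_mul]
    all_goals
      have := Continuous.integrableOn_Ioc hdens (a := 0) (b := t) (μ := volume)
      have hbt : Measurable (b t) := hbm.comp measurable_prodMk_left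
      refine Integrable.bdd_mul (c := ‖f‖) (Integrable.const_mul ?_ _)
        hbt.aestronglyMeasurable (.of_forall fun s => hbb t s)
      first | exact this | exact (h.integrableOn_waitDensity e).mono_set (Ioi_subset_Ioi ht0)
  have hright : ∀ s ∈ Ioi (0 : ℝ),
      ∫ t in Ioi (0 : ℝ), b t s * (Real.exp (-t) * waitDensity a lam e s)
      = Real.exp (-s) * waitDensity a lam e s * h.resolvent f (jump a s e) := by
    intro s hs
    have hs0 : (0 : ℝ) < s := hs
    rw [resolvent_apply, ← integral_const_mul, ← integral_indicator measurableSet_Ioi,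
      ← integral_indicator measurableSet_Ioi, ← integral_add_right_eq_self _ s]
    refine integral_congr_ae ?_
    -- At `r = 0` the closed condition `s ≤ t` and the open half-line disagree.
    filter_upwards [Measure.ae_ne volume (0 : ℝ)] with r hr0
    rcases lt_or_gt_of_ne hr0 with hr | hr
    · have h1 : ¬ s ≤ r + s := by linarith
      simp only [indicator, mem_Ioi, b, if_neg h1, zero_mul, ite_self, not_lt.mpr hr.le, if_false]
    · have h1 : s ≤ r + s := by linarith
      have h2 : 0 < r + s := by linarith
      simp only [indicator, mem_Ioi, b, if_pos h1, h2, hr, if_true, add_sub_cancel_right,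
        neg_add, Real.exp_add]
      ring
  rw [setIntegral_congr_fun measurableSet_Ioi hleft,
    setIntegral_congr_fun measurableSet_Ioi hright] at hswap
  have hi1 : IntegrableOn (fun t => Real.exp (-t) * (survival a lam t e * f (flow a t e)))
      (Ioi 0) := by
    refine Integrable.mono' ((integrableOn_exp_neg_Ioi 0).mul_const ‖f‖)
      (Continuous.aestronglyMeasurable (by have := f.continuous; fun_prop))
      ((ae_restrict_iff' measurableSet_Ioi).mpr (.of_forall fun t ht => ?_))
    rw [norm_mul, norm_mul, Real.norm_of_nonneg (Real.exp_pos _).le,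
      Real.norm_of_nonneg (survival_pos _ _).le]
    refine mul_le_mul_of_nonneg_left ?_ (Real.exp_pos _).le
    calc _ ≤ 1 * ‖f‖ := mul_le_mul (h.survival_le_one (le_of_lt ht) e) (abs_zeroAtInfty_le f _)
          (abs_nonneg _) zero_le_one
      _ = ‖f‖ := one_mul _
  have hi2 : IntegrableOn (fun s => Real.exp (-s) * waitDensity a lam e s
      * h.resolvent f (jump a s e)) (Ioi 0) := by
    have := (h.resolvent f).continuous
    refine Integrable.mono' ((h.integrableOn_waitDensity e).mul_const ‖h.resolvent f‖)
      (Continuous.aestronglyMeasurable (by fun_prop))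
      ((ae_restrict_iff' measurableSet_Ioi).mpr (.of_forall fun t ht => ?_))
    rw [norm_mul, norm_mul, Real.norm_of_nonneg (Real.exp_pos _).le,
      Real.norm_of_nonneg (h.waitDensity_nonneg _ _)]
    refine mul_le_mul ?_ (abs_zeroAtInfty_le _ _) (norm_nonneg _) (h.waitDensity_nonneg _ _)
    exact mul_le_of_le_one_left (h.waitDensity_nonneg _ _)
      (Real.exp_le_one_iff.mpr (neg_nonpos.mpr (le_of_lt ht)))
  simp only [mul_sub] at hswap
  rw [integral_sub (h.integrableOn_exp_mul_mean f e 0) hi1, ← resolvent_apply,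
    sub_eq_iff_eq_add, ← integral_add hi2 hi1] at hswap
  have heq : (fun t : ℝ => Real.exp (-t) * survival a lam t e
      * (f (flow a t e) + lam (flow a t e) * h.resolvent f (jump a t e)))
      = fun t => Real.exp (-t) * waitDensity a lam e t * h.resolvent f (jump a t e)
        + Real.exp (-t) * (survival a lam t e * f (flow a t e)) := by
    funext t
    simp only [waitDensity]
    ring
  rw [heq]
  exact ⟨hi2.add hi1, hswap⟩

end IsAdmissible

end ZigZag
namespace ZigZag

/-! ### The generator -/

variable {a : ℝ} {lam : E → ℝ}

lemma integral_Ioi_comp_add (g : ℝ → ℝ) (c : ℝ) :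
    ∫ t in Ioi (0 : ℝ), g (t + c) = ∫ t in Ioi c, g t := by
  rw [← integral_indicator measurableSet_Ioi, ← integral_indicator measurableSet_Ioi,
    ← integral_add_right_eq_self ((Ioi c).indicator g) c]
  congr 1
  funext t
  simp only [indicator, mem_Ioi, lt_add_iff_pos_left]

lemma hasDerivAt_of_hasDerivAt_flow {w : E → ℝ} {e : E} {d : ℝ} (ha : 0 < a)
    (hw : HasDerivAt (fun t : ℝ => w (flow a t e)) d 0) :
    HasDerivAt (fun y : ℝ => w (y, e.2)) (d * (sgn e.2 / a)) e.1 := by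
  have h1 : HasDerivAt (fun y : ℝ => (y - e.1) * (sgn e.2 / a)) (sgn e.2 / a) e.1 := by
    simpa using ((hasDerivAt_id e.1).sub_const e.1).mul_const (sgn e.2 / a)
  have h2 : HasDerivAt (fun t : ℝ => w (flow a t e)) d ((e.1 - e.1) * (sgn e.2 / a)) := by
    rwa [sub_self, zero_mul]
  refine (h2.comp e.1 h1).congr_of_eventuallyEq (.of_forall fun y => ?_)
  have h3 : e.1 + a * sgn e.2 * ((y - e.1) * (sgn e.2 / a)) = y := by
    have := ha.ne'
    have hs := sgn_mul_self e.2
    field_simp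
    linear_combination (y - e.1) * hs
  simp only [Function.comp_apply, flow, h3]

namespace IsAdmissible

variable (h : IsAdmissible a lam)

/-- By `survival_add`, starting further along the flow only removes an initial piece of the integral
in `resolvent_eq` and rescales the rest. The quotient in `key` is differentiable although `f` and
`lam` are merely continuous. -/
lemma hasDerivAt_resolvent_flow (f : C₀(E, ℝ)) (e : E) :
    HasDerivAt (fun t : ℝ => h.resolvent f (flow a t e))
      ((1 + lam e) * h.resolvent f e - (f e + lam e * h.resolvent f (e.1, -e.2))) 0 := by
  set q : ℝ → ℝ := fun t => Real.exp (-t) * survival a lam t e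
    * (f (flow a t e) + lam (flow a t e) * h.resolvent f (jump a t e)) with hq
  have hqc : Continuous q := by
    have hec : Continuous fun t : ℝ => (t, e) := by fun_prop
    have hsurv : Continuous fun t : ℝ => survival a lam t e := h.continuous_survival.comp hec
    have hflow : Continuous fun t : ℝ => flow a t e := (continuous_flow a).comp hec
    have hjump : Continuous fun t : ℝ => jump a t e := (continuous_jump a).comp hec
    have h1 := map_continuous f
    have h2 := map_continuous (h.resolvent f)
    have h3 := h.continuous
    fun_prop
  obtain ⟨hqi, hqe⟩ := h.resolvent_eq f e
  have hpos : ∀ t, 0 < Real.exp (-t) * survival a lam t e := fun t =>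
    mul_pos (Real.exp_pos _) (survival_pos _ _)
  have key : ∀ t, h.resolvent f (flow a t e)
      = (h.resolvent f e - ∫ s in (0 : ℝ)..t, q s) / (Real.exp (-t) * survival a lam t e) := by
    intro t
    rw [eq_div_iff (hpos t).ne', (h.resolvent_eq f (flow a t e)).2, mul_comm, hqe,
      ← intervalIntegral.integral_interval_add_Ioi' (hqc.intervalIntegrable 0 t)
        (((hqc.integrableOn_Ioc (a := t) (b := 0)).union hqi).mono_set fun s hs =>
          (le_or_gt s 0).imp (fun hs0 => ⟨hs, hs0⟩) id),
      add_sub_cancel_left, ← integral_Ioi_comp_add q t, ← integral_const_mul]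
    congr 1
    funext s
    simp only [hq, add_comm s t, neg_add, Real.exp_add, h.survival_add, flow_flow, jump_flow]
    ring
  have h1 : HasDerivAt (fun t => h.resolvent f e - ∫ s in (0 : ℝ)..t, q s) (-q 0) 0 :=
    (hqc.integral_hasStrictDerivAt 0 0).hasDerivAt.const_sub _
  have h2 : HasDerivAt (fun t => Real.exp (-t) * survival a lam t e)
      (-(1 + lam e)) 0 := by
    refine ((hasDerivAt_neg (0 : ℝ)).exp.mul (h.hasDerivAt_survival 0 e)).congr_deriv ?_
    simp only [flow_zero, survival_zero, neg_zero, Real.exp_zero]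
    ring
  have h3 := h1.div h2 (hpos 0).ne'
  refine (h3.congr_of_eventuallyEq (.of_forall key)).congr_deriv ?_
  have hj : jump a 0 e = (e.1, -e.2) := by simp [jump]
  simp only [hq, flow_zero, hj, survival_zero, neg_zero, Real.exp_zero,
    intervalIntegral.integral_same]
  ring

lemma hasDerivAt_resolvent (f : C₀(E, ℝ)) (e : E) :
    HasDerivAt (fun y : ℝ => h.resolvent f (y, e.2))
      (((1 + lam e) * h.resolvent f e - (f e + lam e * h.resolvent f (e.1, -e.2)))
        * (sgn e.2 / a)) e.1 :=
  hasDerivAt_of_hasDerivAt_flow h.speed_pos (h.hasDerivAt_resolvent_flow f e)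

lemma genExpr_resolvent (f : C₀(E, ℝ)) : genExpr a lam (h.resolvent f) = h.resolvent f - f := by
  funext e
  rw [genExpr, (h.hasDerivAt_resolvent f e).deriv, Pi.sub_apply]
  have := h.speed_pos.ne'
  have hs := sgn_mul_self e.2
  field_simp
  linear_combination ((1 + lam e) * h.resolvent f e
    - (f e + lam e * h.resolvent f (e.1, -e.2))) * hs

lemma inDomain_resolvent (f : C₀(E, ℝ)) : InDomain a lam (h.resolvent f) := by
  refine ⟨fun j => contDiff_one_iff_deriv.mpr ⟨fun y =>
    (h.hasDerivAt_resolvent f (y, j)).differentiableAt, ?_⟩, ?_, ?_⟩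
  · have hd : deriv (fun y : ℝ => h.resolvent f (y, j)) = fun y =>
        ((1 + lam (y, j)) * h.resolvent f (y, j)
          - (f (y, j) + lam (y, j) * h.resolvent f (y, -j))) * (sgn j / a) := by
      funext y
      exact (h.hasDerivAt_resolvent f (y, j)).deriv
    rw [hd]
    have h1 := map_continuous f
    have h2 := map_continuous (h.resolvent f)
    have h3 := h.continuous
    fun_prop
  · rw [genExpr_resolvent]
    exact (map_continuous (h.resolvent f)).sub (map_continuous f)
  · rw [genExpr_resolvent]
    exact (h.resolvent f - f).zero_at_infty'

/-! ### The resolvent takes values in the domain of the generator -/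

/-- Fubini and the semigroup property give `P_t R f = eᵗ ∫_t^∞ e⁻ʳ P_r f dr`, the shifted tail of
the resolvent integral. -/
lemma mean_resolvent (f : C₀(E, ℝ)) (t : ℝ≥0) (e : E) :
    h.mean (h.resolvent f) t e = Real.exp t *
      (h.resolvent f e - ∫ r in (0 : ℝ)..t, Real.exp (-r) * h.mean f r.toNNReal e) := by
  have hint : Integrable (Function.uncurry fun (y : E) (s : ℝ) =>
      Real.exp (-s) * h.mean f s.toNNReal y)
      ((h.semigroup t e).prod (volume.restrict (Ioi (0 : ℝ)))) := by
    have h1 := (integrable_const (μ := h.semigroup t e) ‖f‖).mul_prod (integrableOn_exp_neg_Ioi 0)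
    refine h1.mono' ?_ (.of_forall fun p => ?_)
    · exact ((h.continuous_exp_mul_mean f).comp continuous_swap).aestronglyMeasurable
    · exact (h.abs_exp_mul_mean_le f p.2 p.1).trans_eq (mul_comm _ _)
  have hswap := integral_integral_swap hint
  have hi := h.integrableOn_exp_mul_mean f e
  rw [mean]
  simp only [resolvent_apply]
  rw [hswap, ← intervalIntegral.integral_interval_add_Ioi (hi 0) (hi t), add_sub_cancel_left,
    ← integral_Ioi_comp_add _ (t : ℝ), ← integral_const_mul]
  refine setIntegral_congr_fun measurableSet_Ioi fun s hs => ?_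
  have hs0 : (0 : ℝ) ≤ s := le_of_lt hs
  have hst : (s + t).toNNReal = t + s.toNNReal := by
    rw [Real.toNNReal_add hs0 t.coe_nonneg, Real.toNNReal_coe, add_comm]
  simp only [hst, mean_add, integral_const_mul, neg_add, Real.exp_add]
  have : Real.exp (t : ℝ) * Real.exp (-(t : ℝ)) = 1 := by
    rw [← Real.exp_add, add_neg_cancel, Real.exp_zero]
  linear_combination (-Real.exp (-s) * ∫ y, h.mean f s.toNNReal y ∂(h.semigroup t e)) * this

/-- By `mean_resolvent` the difference quotient is `((eᵗ - 1) / t) R f` minus an average of `eᵗ⁻ʳ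
P_r f` over `r ≤ t`; strong continuity makes that average tend uniformly to `f`. -/
lemma resolvent_mem_generatorGraph (f : C₀(E, ℝ)) :
    (h.resolvent f, h.resolvent f - f) ∈ generatorGraph h.semigroup := by
  set w := h.resolvent f with hw
  refine Metric.tendstoUniformly_iff.mpr fun ε hε => ?_
  have hA : Tendsto (fun t : ℝ≥0 => |(Real.exp t - 1) / t - 1| * ‖w‖ + (Real.exp t - 1) * ‖f‖)
      (𝓝[>] 0) (𝓝 0) := by
    have hc : Tendsto (fun t : ℝ≥0 => (t : ℝ)) (𝓝[>] 0) (𝓝[≠] 0) := by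
      refine tendsto_nhdsWithin_iff.mpr ⟨(NNReal.continuous_coe.tendsto' 0 0 rfl).mono_left
        nhdsWithin_le_nhds, ?_⟩
      filter_upwards [self_mem_nhdsWithin] with t ht
      exact NNReal.coe_ne_zero.mpr (ne_of_gt ht)
    have h1 := (hasDerivAt_iff_tendsto_slope.mp (Real.hasDerivAt_exp 0)).comp hc
    have h2 : Tendsto (fun t : ℝ≥0 => Real.exp t) (𝓝[>] 0) (𝓝 1) := by
      have := (Real.continuous_exp.tendsto' 0 1 Real.exp_zero).comp (hc.mono_right
        nhdsWithin_le_nhds)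
      exact this
    have h3 : Tendsto (fun t : ℝ≥0 => (Real.exp t - 1) / t) (𝓝[>] 0) (𝓝 1) := by
      rw [Real.exp_zero] at h1
      refine h1.congr fun t => ?_
      simp only [Function.comp_apply, slope_def_field, Real.exp_zero, sub_zero]
    have h4 := ((h3.sub_const 1).abs.mul_const ‖w‖).add ((h2.sub_const 1).mul_const ‖f‖)
    simpa using h4
  obtain ⟨δ, hδ, hδf⟩ := Metric.eventually_nhds_iff.mp
    (h.eventually_abs_mean_sub_le f (half_pos hε))
  have hδ' : ∀ᶠ t : ℝ≥0 in 𝓝[>] 0, dist t 0 < δ :=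
    nhdsWithin_le_nhds (Metric.ball_mem_nhds 0 hδ)
  filter_upwards [hA.eventually_lt_const (half_pos hε), hδ', self_mem_nhdsWithin] with t ht htδ ht0 e
  have ht0' : (0 : ℝ) < t := ht0
  have hm := h.mean_resolvent f t e
  rw [← hw] at hm
  set I := ∫ r in (0 : ℝ)..t, Real.exp (-r) * h.mean f r.toNNReal e with hI
  have hbound : |Real.exp t * I - t * f e| ≤ (ε / 2 + (Real.exp t - 1) * ‖f‖) * t := by
    have hcr : Continuous fun r : ℝ => Real.exp (-r) * h.mean f r.toNNReal e :=
      h.continuous_exp_mul_mean_left f e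
    have h1 : Real.exp t * I - t * f e
        = ∫ r in (0 : ℝ)..t, (Real.exp t * (Real.exp (-r) * h.mean f r.toNNReal e) - f e) := by
      rw [intervalIntegral.integral_sub ((hcr.intervalIntegrable _ _).const_mul _)
        intervalIntegrable_const, intervalIntegral.integral_const_mul,
        intervalIntegral.integral_const, sub_zero, smul_eq_mul]
    rw [h1]
    have h2 := intervalIntegral.norm_integral_le_of_norm_le_const (a := (0 : ℝ)) (b := t)
      (C := ε / 2 + (Real.exp t - 1) * ‖f‖)
      (f := fun r => Real.exp t * (Real.exp (-r) * h.mean f r.toNNReal e) - f e) fun r hr => ?_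
    · rwa [sub_zero, abs_of_pos ht0'] at h2
    rw [uIoc_of_le ht0'.le] at hr
    have hr0 : 0 ≤ r := hr.1.le
    have hrδ : dist r.toNNReal 0 < δ := by
      rw [NNReal.dist_eq, NNReal.coe_zero, sub_zero, abs_of_nonneg (NNReal.coe_nonneg _)] at htδ ⊢
      rw [Real.coe_toNNReal r hr0]
      exact hr.2.trans_lt htδ
    have h3 := hδf hrδ e
    have h4 := h.abs_mean_le f r.toNNReal e
    have h5 : 1 ≤ Real.exp (t - r) := Real.one_le_exp (sub_nonneg.mpr hr.2)
    have h6 : Real.exp (t - r) ≤ Real.exp t := Real.exp_le_exp.mpr (by linarith)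
    have h7 : Real.exp t * (Real.exp (-r) * h.mean f r.toNNReal e) - f e
        = (h.mean f r.toNNReal e - f e) + (Real.exp (t - r) - 1) * h.mean f r.toNNReal e := by
      rw [sub_eq_add_neg (t : ℝ) r, Real.exp_add]
      ring
    rw [h7, Real.norm_eq_abs]
    refine (abs_add_le _ _).trans (add_le_add h3 ?_)
    rw [abs_mul, abs_of_nonneg (sub_nonneg.mpr h5)]
    exact mul_le_mul (by linarith) h4 (abs_nonneg _) (by linarith)
  have hsplit : (w e - f e) - (h.mean w t e - w e) / t
      = -(((Real.exp t - 1) / t - 1) * w e) + (Real.exp t * I - t * f e) / t := by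
    rw [hm]
    field_simp
    ring
  change dist ((w - f) e) ((h.mean w t e - w e) / t) < ε
  rw [ZeroAtInftyContinuousMap.sub_apply, Real.dist_eq, hsplit]
  refine (abs_add_le _ _).trans_lt ?_
  rw [abs_neg, abs_mul, abs_div, abs_of_pos ht0']
  have h8 := mul_le_mul_of_nonneg_left (abs_zeroAtInfty_le w e)
    (abs_nonneg ((Real.exp t - 1) / t - 1))
  have h9 := (div_le_iff₀ ht0').mpr hbound
  linarith

end IsAdmissible

/-! ### The positive maximum principle -/

/-- A function in `C₀(E)` with a positive value attains its maximum, so only maximum points need to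
be tested. -/
lemma nonpos_of_forall_isMax {χ : C₀(E, ℝ)} (hχ : ∀ x, (∀ y, χ y ≤ χ x) → χ x ≤ 0) (e : E) :
    χ e ≤ 0 := by
  by_contra! he
  obtain ⟨x, hx⟩ := (map_continuous χ).exists_forall_ge' e
    ((χ.zero_at_infty'.eventually_lt_const he).mono fun _ => le_of_lt)
  exact absurd (hχ x hx) (not_le.mpr (he.trans_le (hx e)))

lemma nonpos_of_genExpr_eq (hlam : ∀ x, 0 ≤ lam x) {χ : C₀(E, ℝ)} (hχ : genExpr a lam χ = χ)
    (e : E) : χ e ≤ 0 := by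
  refine nonpos_of_forall_isMax (fun x hx => ?_) e
  -- At a maximum the transport term vanishes and the switching term is nonpositive. No
  -- differentiability is needed, `deriv` being `0` by default.
  have h1 : deriv (fun y : ℝ => χ (y, x.2)) x.1 = 0 :=
    IsLocalMax.deriv_eq_zero (.of_forall fun y => hx (y, x.2))
  rw [← congrFun hχ x, genExpr, h1, mul_zero, zero_add]
  exact mul_nonpos_of_nonneg_of_nonpos (hlam x) (sub_nonpos.mpr (hx _))

lemma eq_zero_of_genExpr_eq (hlam : ∀ x, 0 ≤ lam x) {χ : C₀(E, ℝ)} (hχ : genExpr a lam χ = χ) :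
    χ = 0 := by
  have h1 : genExpr a lam (-χ : C₀(E, ℝ)) = (-χ : C₀(E, ℝ)) := by
    have := genExpr_smul (a := a) (lam := lam) (φ := χ) (-1)
    rw [hχ, neg_one_smul] at this
    exact this
  ext e
  have h2 := nonpos_of_genExpr_eq hlam h1 e
  rw [ZeroAtInftyContinuousMap.neg_apply] at h2
  exact le_antisymm (nonpos_of_genExpr_eq hlam hχ e) (neg_nonpos.mp h2)

namespace IsAdmissible

variable (h : IsAdmissible a lam)

lemma sub_mem_generatorGraph {p q : C₀(E, ℝ) × C₀(E, ℝ)} (hp : p ∈ generatorGraph h.semigroup)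
    (hq : q ∈ generatorGraph h.semigroup) : p - q ∈ generatorGraph h.semigroup := by
  have hpq := TendstoUniformly.sub hp hq
  have heq : (fun (t : ℝ≥0) e => (h.mean (p.1 - q.1) t e - (p.1 - q.1) e) / (t : ℝ))
      = (fun (t : ℝ≥0) e => (h.mean p.1 t e - p.1 e) / (t : ℝ))
        - fun (t : ℝ≥0) e => (h.mean q.1 t e - q.1 e) / (t : ℝ) := by
    funext t e
    simp only [Pi.sub_apply, mean_sub, ZeroAtInftyContinuousMap.sub_apply]
    ring
  change TendstoUniformly (fun (t : ℝ≥0) e =>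
    (h.mean (p.1 - q.1) t e - (p.1 - q.1) e) / (t : ℝ)) (p.2 - q.2 : C₀(E, ℝ)) (𝓝[>] 0)
  rw [heq]
  exact hpq

/-- At a maximum point averaging cannot increase `χ`, so all difference quotients there are
nonpositive. -/
lemma nonpos_of_mem_generatorGraph {χ : C₀(E, ℝ)} (hχ : (χ, χ) ∈ generatorGraph h.semigroup)
    (e : E) : χ e ≤ 0 := by
  refine nonpos_of_forall_isMax (fun x hx => ?_) e
  refine le_of_tendsto (TendstoUniformly.tendsto_at hχ x) (.of_forall fun t => ?_)
  refine div_nonpos_of_nonpos_of_nonneg (sub_nonpos.mpr ?_) t.coe_nonneg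
  have hi : Integrable χ (h.semigroup t x) :=
    Integrable.of_bound (map_continuous χ).aestronglyMeasurable ‖χ‖
      (.of_forall (abs_zeroAtInfty_le χ))
  simpa using integral_mono hi (integrable_const (χ x)) hx

lemma eq_zero_of_mem_generatorGraph {χ : C₀(E, ℝ)}
    (hχ : (χ, χ) ∈ generatorGraph h.semigroup) : χ = 0 := by
  have h0 : ((0 : C₀(E, ℝ)), (0 : C₀(E, ℝ))) ∈ generatorGraph h.semigroup := by
    have := h.sub_mem_generatorGraph hχ hχ
    rwa [sub_self] at this
  have h1 : (-χ, -χ) ∈ generatorGraph h.semigroup := by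
    have := h.sub_mem_generatorGraph h0 hχ
    rwa [Prod.mk_sub_mk, zero_sub] at this
  ext e
  have h2 := h.nonpos_of_mem_generatorGraph h1 e
  rw [ZeroAtInftyContinuousMap.neg_apply] at h2
  exact le_antisymm (h.nonpos_of_mem_generatorGraph hχ e) (neg_nonpos.mp h2)

/-! ### Identification of the generator -/

/-- The resolvent supplies a point of the graph with the same difference of components as `p`.
Subtracting `p` leaves a pair `(χ, χ)`, which vanishes by the maximum principle. -/
lemma mem_generatorGraph_iff (p : C₀(E, ℝ) × C₀(E, ℝ)) :
    p ∈ generatorGraph h.semigroup ↔ h.resolvent (p.1 - p.2) = p.1 := by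
  have hR := h.resolvent_mem_generatorGraph (p.1 - p.2)
  constructor
  · intro hp
    refine sub_eq_zero.mp (h.eq_zero_of_mem_generatorGraph ?_)
    have := h.sub_mem_generatorGraph hR hp
    rwa [← Prod.mk.eta (p := p), Prod.mk_sub_mk, show h.resolvent (p.1 - p.2) - (p.1 - p.2) - p.2
      = h.resolvent (p.1 - p.2) - p.1 by abel] at this
  · intro hp
    rw [hp, sub_sub_cancel] at hR
    exact hR

lemma mem_graph_iff (p : C₀(E, ℝ) × C₀(E, ℝ)) :
    p ∈ (L a lam).graph ↔ h.resolvent (p.1 - p.2) = p.1 := by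
  have hmem : ∀ q : C₀(E, ℝ) × C₀(E, ℝ),
      q ∈ (L a lam).graph ↔ InDomain a lam q.1 ∧ genExpr a lam q.1 = q.2 := by
    intro q
    rw [LinearPMap.mem_graph_iff]
    constructor
    · rintro ⟨φ, hφ1, hφ2⟩
      exact ⟨hφ1 ▸ φ.2, by rw [← hφ1, ← hφ2]; rfl⟩
    · rintro ⟨h1, h2⟩
      exact ⟨⟨q.1, h1⟩, rfl, DFunLike.coe_injective h2⟩
  have hR : (h.resolvent (p.1 - p.2), h.resolvent (p.1 - p.2) - (p.1 - p.2))
      ∈ (L a lam).graph := (hmem _).mpr ⟨h.inDomain_resolvent _, h.genExpr_resolvent _⟩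
  constructor
  · intro hp
    refine sub_eq_zero.mp (eq_zero_of_genExpr_eq h.nonneg (a := a) (lam := lam) ?_)
    have := (L a lam).graph.sub_mem hR hp
    rw [← Prod.mk.eta (p := p), Prod.mk_sub_mk, show h.resolvent (p.1 - p.2) - (p.1 - p.2) - p.2
      = h.resolvent (p.1 - p.2) - p.1 by abel] at this
    exact ((hmem _).mp this).2
  · intro hp
    rw [hp, sub_sub_cancel] at hR
    exact hR

/-- The graph is the solution set of an equation between continuous maps, so taking the closure adds
nothing. -/
lemma isClosed_L (h : IsAdmissible a lam) : (L a lam).IsClosed := by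
  have hset : ((L a lam).graph : Set (C₀(E, ℝ) × C₀(E, ℝ)))
      = {p | h.resolvent (p.1 - p.2) = p.1} := Set.ext h.mem_graph_iff
  rw [LinearPMap.IsClosed, hset]
  exact isClosed_eq (h.continuous_resolvent.comp (continuous_fst.sub continuous_snd))
    continuous_fst

lemma generatorGraph_semigroup :
    generatorGraph h.semigroup = ((L a lam).closure.graph : Set _) := by
  rw [← h.isClosed_L.isClosable.graph_closure_eq_closure_graph,
    Submodule.topologicalClosure_coe, IsClosed.closure_eq h.isClosed_L]
  exact Set.ext fun p => (h.mem_generatorGraph_iff p).trans (h.mem_graph_iff p).symm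

end IsAdmissible

end ZigZag

/-! ### The theorem, with `seqKernel` as canonical version and `semigroup` as transition semigroup
-/

theorem mainTheorem8 (a : ℝ) (ha : 0 < a) (lam : ZigZag.E → ℝ) (hcont : Continuous lam)
    (hnonneg : ∀ x, 0 ≤ lam x)
    (hlam : ∃ y₀ : ℝ, 0 ≤ y₀ ∧ ∃ lamMin : ℝ, 0 < lamMin ∧
      ∀ (y : ℝ) (j : ℤˣ), y₀ ≤ ZigZag.sgn j * y → lamMin ≤ lam (y, j)) :
    (ZigZag.L a lam).IsClosable ∧
    ∃ P : ℝ≥0 → Kernel ZigZag.E ZigZag.E,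
      ZigZag.IsMarkovSemigroup P ∧
      ZigZag.generatorGraph P = ((ZigZag.L a lam).closure.graph : Set _) ∧
      ∀ e : ZigZag.E,
        -- the process exists
        (∃ μ : Measure (ℕ → Ioi (0 : ℝ)),
          ZigZag.IsWaitingTimes a lam e μ (fun n ω => ω n)) ∧
        -- and every version of it has the asserted properties
        ∀ (Ω : Type*) (mΩ : MeasurableSpace Ω) (μ : Measure Ω) (Z : ℕ → Ω → Ioi (0 : ℝ))
          (hZ : ZigZag.IsWaitingTimes a lam e μ Z),
          (∀ᵐ ω ∂μ, Tendsto (ZigZag.switchTime fun k => Z k ω) atTop atTop) ∧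
          (∀ t, μ.map (ZigZag.process a e Z t) = P t e) ∧
          ZigZag.IsStrongMarkov μ (ZigZag.filtration a e hZ.measurable)
            (ZigZag.process a e Z) P := by
  have h : ZigZag.IsAdmissible a lam := ⟨ha, hcont, hnonneg, hlam⟩
  exact ⟨h.isClosed_L.isClosable, h.semigroup, h.isMarkovSemigroup, h.generatorGraph_semigroup,
    fun e => ⟨⟨h.seqKernel e, h.isWaitingTimes_seqKernel e⟩, fun _ _ _ _ hZ =>
      ⟨hZ.ae_tendsto_switchTime h, hZ.map_process h, hZ.isStrongMarkov h⟩⟩⟩
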